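/- Let $p_1,p_2$ be positive integers and let $X=(X_1,X_2)$, $X_i\in\mathbb{R}^{p_i}$, be a zero-mean jointly Gaussian vector with covariance matrix $Q\succeq 0$ of size $p_1+p_2$. For $\Delta_1,\Delta_2\in[0,\infty)$ let $$R(\Delta_1,\Delta_2)=\inf I(X_1,X_2;\widehat X_1,\widehat X_2)\in[0,\infty],$$ where the infimum is over all joint distributions of $(X,\widehat X)$, $\widehat X=(\widehat X_1,\widehat X_2)\in\mathbb{R}^{p_1}\times\mathbb{R}^{p_2}$, with the given marginal of $X$ and with $\mathbf{E}\|X_i-\widehat X_i\|^2\le\Delta_i$, $i=1,2$ (mutual information in nats). For a matrix $\Sigma$ of size $p_1+p_2$ let $\Sigma_{1}$, $\Sigma_{2}$ be its diagonal blocks of sizes $p_1$, $p_2$. Say that $(H,Q_V,\Sigma)$ satisfies (1) if $$HQ=Q-\Sigma=QH^{T}\succeq 0,\qquad Q_V=HQ-HQH^{T}\succeq 0. \tag{1}$$ (a) Consider the realizations $\widehat X=HX+V$ with $V\sim N(0,Q_V)$ independent of $X$, $Q_V\succeq0$. Such a realization satisfies $\mathbf{E}[X\mid\widehat X]=\widehat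 X$ almost surely and has error covariance $\mathbf{E}[EE^T]=\Sigma$, $E=X-\mathbf{E}[X\mid\widehat X]$, if and only if $(H,Q_V,\Sigma)$ satisfies (1). The infimum defining $R(\Delta_1,\Delta_2)$ is attained by such a realization, for some $(H,Q_V,\Sigma)$ that satisfies (1) and $\operatorname{tr}\Sigma_i\le\Delta_i$, $i=1,2$, and for which $R(\Delta_1,\Delta_2)=\frac12\log\frac{\det Q}{\det\Sigma}$. Moreover, $$R(\Delta_1,\Delta_2)=\inf_{\Sigma\in\mathcal{Q}^\dagger(\Delta_1,\Delta_2)}\frac12\log\frac{\det Q}{\det\Sigma},$$ $$\mathcal{Q}^\dagger(\Delta_1,\Delta_2)=\{\Sigma:\ (H,Q_V,\Sigma)\text{ satisfies (1) for some }(H,Q_V),\ \operatorname{tr}\Sigma_{1}\le\Delta_1,\ \operatorname{tr}\Sigma_{2}\le\Delta_2\}.$$ Here, if $Q$ is singular, both determinants are those of the restrictions to the range of $Q$ (by (1), $\Sigma$ maps this range into itself and vanishes on $\ker Q$); the expression is $+\infty$ when the denominator is $0$. (b) Suppose $Q\succ 0$ and $R(\Delta_1,\Delta_2)<\infty$. Then,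 for all $(H,Q_V,\Sigma)$ that satisfy (1), $$H=I-\Sigma Q^{-1},\qquad Q_V=\Sigma-\Sigma Q^{-1}\Sigma\succeq 0,\qquad Q-\Sigma\succeq0;$$ for every $\Sigma\succeq 0$, $Q-\Sigma\succeq 0$ if and only if $\Sigma-\Sigma Q^{-1}\Sigma\succeq 0$; and $\mathcal{Q}^\dagger(\Delta_1,\Delta_2)$ equals $$\{\Sigma:\ Q\succeq\Sigma\succeq 0,\ \operatorname{tr}\Sigma_{1}\le\Delta_1,\ \operatorname{tr}\Sigma_{2}\le\Delta_2\},$$ so that $R(\Delta_1,\Delta_2)$ is the infimum of $\frac12\log\frac{\det Q}{\det\Sigma}$ over this set. -/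

import Mathlib

open MeasureTheory ProbabilityTheory
open scoped ENNReal Matrix

noncomputable section

namespace JointRDF

/-- Index set of the coordinates of a stacked vector `(x₁, x₂)`, `xᵢ ∈ ℝ^{pᵢ}`. -/
abbrev Idx (p₁ p₂ : ℕ) : Type := Fin p₁ ⊕ Fin p₂

/-- The Euclidean space `ℝ^{p₁} × ℝ^{p₂} = ℝ^{p₁ + p₂}` of stacked vectors. -/
abbrev Vec (p₁ p₂ : ℕ) : Type := EuclideanSpace ℝ (Idx p₁ p₂)

/-- Square matrices of size `p₁ + p₂`. -/
abbrev Mat (p₁ p₂ : ℕ) : Type := Matrix (Idx p₁ p₂) (Idx p₁ p₂) ℝ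

/-- The zero-mean Gaussian law `G(0, Q)` on `ℝ^{p₁ + p₂}` (for `Q ⪰ 0`). -/
def gaussian {p₁ p₂ : ℕ} (Q : Mat p₁ p₂) : Measure (Vec p₁ p₂) :=
  multivariateGaussian 0 Q

/-- The mutual information `I(X; Y)`, in nats, of a pair `(X, Y)` with joint law `π`: the
Kullback-Leibler divergence of `π` from the product of its marginals. -/
def mutualInfo {α β : Type*} [MeasurableSpace α] [MeasurableSpace β] (π : Measure (α × β)) :
    ℝ≥0∞ :=
  InformationTheory.klDiv π (π.fst.prod π.snd)

/-- `E ‖X₁ - X̂₁‖²` for a pair `(X, X̂)` with joint law `π`. -/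
def distortion₁ {p₁ p₂ : ℕ} (π : Measure (Vec p₁ p₂ × Vec p₁ p₂)) : ℝ≥0∞ :=
  ∫⁻ z, ENNReal.ofReal (∑ i : Fin p₁, (z.1 (Sum.inl i) - z.2 (Sum.inl i)) ^ 2) ∂π

/-- `E ‖X₂ - X̂₂‖²` for a pair `(X, X̂)` with joint law `π`. -/
def distortion₂ {p₁ p₂ : ℕ} (π : Measure (Vec p₁ p₂ × Vec p₁ p₂)) : ℝ≥0∞ :=
  ∫⁻ z, ENNReal.ofReal (∑ i : Fin p₂, (z.1 (Sum.inr i) - z.2 (Sum.inr i)) ^ 2) ∂π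

/-- The set of joint laws of `(X, X̂)` in which `X` has law `μ` and the two average distortions are
at most `Δ₁` and `Δ₂`. -/
def feasible {p₁ p₂ : ℕ} (μ : Measure (Vec p₁ p₂)) (Δ₁ Δ₂ : ℝ) :
    Set (Measure (Vec p₁ p₂ × Vec p₁ p₂)) :=
  {π | IsProbabilityMeasure π ∧ π.fst = μ ∧
    distortion₁ π ≤ ENNReal.ofReal Δ₁ ∧ distortion₂ π ≤ ENNReal.ofReal Δ₂}

/-- The joint rate distortion function of a source `X = (X₁, X₂)` with law `μ`. -/
def rdf {p₁ p₂ : ℕ} (μ : Measure (Vec p₁ p₂)) (Δ₁ Δ₂ : ℝ) : ℝ≥0∞ :=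
  ⨅ π ∈ feasible μ Δ₁ Δ₂, mutualInfo π

/-- The joint law of `(X, X̂)` for the realization `X̂ = H X + V` with `X ∼ G(0, Q)`,
`V ∼ G(0, QV)`, and `V`, `X` independent. -/
def realizationLaw {p₁ p₂ : ℕ} (Q H QV : Mat p₁ p₂) : Measure (Vec p₁ p₂ × Vec p₁ p₂) :=
  ((gaussian Q).prod (gaussian QV)).map
    (fun xv => (xv.1, Matrix.toEuclideanCLM (𝕜 := ℝ) H xv.1 + xv.2))

/-- The conditional mean `E[X | X̂]` for a pair `(X, X̂)` with joint law `π`. -/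
def condMean {p₁ p₂ : ℕ} (π : Measure (Vec p₁ p₂ × Vec p₁ p₂)) :
    Vec p₁ p₂ × Vec p₁ p₂ → Vec p₁ p₂ :=
  π[Prod.fst | MeasurableSpace.comap Prod.snd inferInstance]

/-- The covariance `E[E Eᵀ]` of the error `E = X - E[X | X̂]`. -/
def errorCov {p₁ p₂ : ℕ} (π : Measure (Vec p₁ p₂ × Vec p₁ p₂)) : Mat p₁ p₂ :=
  Matrix.of fun i j => ∫ z, (z.1 - condMean π z) i * (z.1 - condMean π z) j ∂π

/-- The conditions `H Q = Q - S = Q Hᵀ ⪰ 0` and `QV = H Q - H Q Hᵀ ⪰ 0`. -/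
structure Realizes {p₁ p₂ : ℕ} (Q H QV S : Mat p₁ p₂) : Prop where
  left_eq : H * Q = Q - S
  right_eq : Q - S = Q * Hᵀ
  posSemidef : (H * Q).PosSemidef
  noise_eq : QV = H * Q - H * Q * Hᵀ
  noise_posSemidef : QV.PosSemidef

/-- The two constraints `tr S₁₁ ≤ Δ₁` and `tr S₂₂ ≤ Δ₂` on the diagonal blocks of `S`. -/
def TraceLE {p₁ p₂ : ℕ} (S : Mat p₁ p₂) (Δ₁ Δ₂ : ℝ) : Prop :=
  S.toBlocks₁₁.trace ≤ Δ₁ ∧ S.toBlocks₂₂.trace ≤ Δ₂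

/-- The error covariances `S` that belong to some pair `(H, QV)` and meet the trace constraints. -/
def constraintSet {p₁ p₂ : ℕ} (Q : Mat p₁ p₂) (Δ₁ Δ₂ : ℝ) : Set (Mat p₁ p₂) :=
  {S | (∃ H QV : Mat p₁ p₂, Realizes Q H QV S) ∧ TraceLE S Δ₁ Δ₂}

/-- The matrices `S` with `Q ⪰ S ⪰ 0` that meet the trace constraints. -/
def constraintSetPD {p₁ p₂ : ℕ} (Q : Mat p₁ p₂) (Δ₁ Δ₂ : ℝ) : Set (Mat p₁ p₂) :=
  {S | (Q - S).PosSemidef ∧ S.PosSemidef ∧ TraceLE S Δ₁ Δ₂}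

/-- `½ log (a / b)` for `a > 0`, `b ≥ 0`, with value `+∞` at `b = 0`. -/
def halfLogRatio (a b : ℝ) : EReal :=
  if 0 < b then ((1 / 2 * Real.log (a / b) : ℝ) : EReal) else ⊤

/-- The matrix of the orthogonal projection of `ℝ^{p₁ + p₂}` onto the kernel of `Q`. -/
def kerProj {p₁ p₂ : ℕ} (Q : Mat p₁ p₂) : Mat p₁ p₂ :=
  (Matrix.toEuclideanCLM (n := Idx p₁ p₂) (𝕜 := ℝ)).symm
    (LinearMap.ker (Matrix.toEuclideanLin Q)).starProjection

/-- `½ log (det Q / det S)` with both determinants taken on the range of `Q`.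
For symmetric `Q` and a symmetric `S` that vanishes on `ker Q`, both matrices are block diagonal
along `range Q ⊕ ker Q`, and adding the projection onto `ker Q` replaces the zero block by an
identity. For invertible `Q` this is literally `½ log (det Q / det S)`; for singular `Q`
it gives a value to the quotient `0 / 0`. -/
def rate {p₁ p₂ : ℕ} (Q S : Mat p₁ p₂) : EReal :=
  halfLogRatio (Q + kerProj Q).det (S + kerProj Q).det

theorem kerProj_of_posDef {p₁ p₂ : ℕ} {Q : Mat p₁ p₂} (hQ : Q.PosDef) : kerProj Q = 0 := by
  have h : LinearMap.ker (Matrix.toEuclideanLin Q) = ⊥ := by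
    rw [LinearMap.ker_eq_bot']
    intro x hx
    have h1 : Q *ᵥ x.ofLp = 0 := by
      rw [← Matrix.ofLp_toEuclideanLin_apply, hx]; rfl
    have h2 := Matrix.eq_zero_of_mulVec_eq_zero hQ.det_pos.ne' h1
    ext i
    exact congrFun h2 i
  simp [kerProj, h]

theorem rate_of_posDef {p₁ p₂ : ℕ} {Q : Mat p₁ p₂} (hQ : Q.PosDef) (S : Mat p₁ p₂) :
    rate Q S = halfLogRatio Q.det S.det := by
  simp [rate, kerProj_of_posDef hQ]

end JointRDF

end

noncomputable section

namespace JointRDF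

/-! ### The kernel projection and the constraint set -/

section MatrixFacts

variable {p₁ p₂ : ℕ} {Q S : Mat p₁ p₂}

/-! Lower bound. Let `(X, Y)` be feasible and let `A` be the matrix of the best linear estimate of
`X` from `Y`. Its error covariance `S` satisfies `0 ⪯ S ⪯ Q`, and replacing `Y` by `A Y` does not
increase either block distortion, so `S` lies in the constraint set (`exists_linear_estimator`). Now
test the divergence of the joint law from the product of its marginals, in the Donsker-Varadhan
inequality `integral_le_klDiv`, against the log-density of the Gaussian kernel `y ↦ G(A y, S)`
relative to `G(0, Q)`. The expectation of this function depends on second moments only; its two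
quadratic terms cancel and `½ log (det Q / det S)` remains (`le_mutualInfo_of_covariance`). When `S`
is too degenerate for a density, it is replaced by `S + ε Q` and `ε` tends to `0`
(`rate_le_mutualInfo`).

Attainment. Under (1) the error `X - X̂` and `X̂` are jointly Gaussian and uncorrelated, hence
independent. When `S` is nondegenerate on the range of `Q`, the same log-density is the exact
log-likelihood ratio of the joint law against the product law, and the bound is an equality
(`Realizes.mutualInfo_le_rate`). Every `S` with `0 ⪯ S ⪯ Q` comes from some `H` and `QV` by a Schur
complement argument (`exists_realizes`), and compactness of the constraint set yields an optimal `S`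
(`exists_rate_minimizer`).

Conditional mean. Independence of error and reproduction gives `E[X | X̂] = X̂`; conversely this
identity forces `E[X X̂ᵀ] = E[X̂ X̂ᵀ]`, which is (1) written in terms of `H` and `QV`.

Singular `Q`. With `P` the projection onto `ker Q`, the matrices `Q + P` and `S + P` stand in for
`Q` and `S`: their inverses act as inverses on the range of `Q` and as the identity on the kernel,
where the extra contributions cancel. -/

theorem toEuclideanCLM_kerProj (Q : Mat p₁ p₂) :
    Matrix.toEuclideanCLM (𝕜 := ℝ) (kerProj Q) =
      (LinearMap.ker (Matrix.toEuclideanLin Q)).starProjection :=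
  StarAlgEquiv.apply_symm_apply _ _

theorem kerProj_transpose (Q : Mat p₁ p₂) : (kerProj Q)ᵀ = kerProj Q := by
  have h : star (kerProj Q) = kerProj Q := by
    refine (Matrix.toEuclideanCLM (n := Idx p₁ p₂) (𝕜 := ℝ)).injective
      ((map_star (Matrix.toEuclideanCLM (n := Idx p₁ p₂) (𝕜 := ℝ)) _).trans ?_)
    change star (Matrix.toEuclideanCLM (𝕜 := ℝ) (kerProj Q)) =
      Matrix.toEuclideanCLM (𝕜 := ℝ) (kerProj Q)
    rw [toEuclideanCLM_kerProj]
    exact isSelfAdjoint_starProjection _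
  rwa [Matrix.star_eq_conjTranspose, Matrix.conjTranspose_eq_transpose_of_trivial] at h

theorem kerProj_mul_self (Q : Mat p₁ p₂) : kerProj Q * kerProj Q = kerProj Q := by
  rw [kerProj, ← map_mul]
  congr 1
  exact Submodule.isIdempotentElem_starProjection _

theorem mulVec_kerProj_mulVec (Q : Mat p₁ p₂) (x : Idx p₁ p₂ → ℝ) :
    Q *ᵥ (kerProj Q *ᵥ x) = 0 := by
  have h : Matrix.toEuclideanCLM (𝕜 := ℝ) (kerProj Q) (WithLp.toLp 2 x) ∈
      LinearMap.ker (Matrix.toEuclideanLin Q) := by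
    rw [toEuclideanCLM_kerProj]
    exact Submodule.starProjection_apply_mem _ _
  rw [LinearMap.mem_ker] at h
  have h2 := congrArg WithLp.ofLp h
  simpa [Matrix.toEuclideanCLM_toLp, Matrix.toLpLin_toLp] using h2

theorem kerProj_mulVec_eq_self {x : Idx p₁ p₂ → ℝ} (hx : Q *ᵥ x = 0) : kerProj Q *ᵥ x = x := by
  have h : WithLp.toLp 2 x ∈ LinearMap.ker (Matrix.toEuclideanLin Q) := by
    rw [LinearMap.mem_ker, Matrix.toLpLin_toLp, Matrix.toLin'_apply, hx]
    rfl
  have h2 := Submodule.starProjection_eq_self_iff.2 h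
  rw [← toEuclideanCLM_kerProj, Matrix.toEuclideanCLM_toLp] at h2
  exact WithLp.toLp_injective 2 h2

theorem mul_kerProj_of_ker_le {B : Mat p₁ p₂} (h : ∀ x, Q *ᵥ x = 0 → B *ᵥ x = 0) :
    B * kerProj Q = 0 := by
  apply Matrix.ext_of_mulVec_single
  intro i
  rw [← Matrix.mulVec_mulVec, h _ (mulVec_kerProj_mulVec Q _), Matrix.zero_mulVec]

theorem mul_kerProj (Q : Mat p₁ p₂) : Q * kerProj Q = 0 := mul_kerProj_of_ker_le fun _ h => h

theorem kerProj_mul_of_mul_kerProj {B : Mat p₁ p₂} (hB : Bᵀ = B) (h : B * kerProj Q = 0) :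
    kerProj Q * B = 0 := by
  have := congrArg Matrix.transpose h
  rwa [Matrix.transpose_mul, kerProj_transpose, hB, Matrix.transpose_zero] at this

theorem _root_.Matrix.PosSemidef.transpose_eq {n : Type*} {A : Matrix n n ℝ} (h : A.PosSemidef) :
    Aᵀ = A := by
  have := h.isHermitian.eq
  rwa [Matrix.conjTranspose_eq_transpose_of_trivial] at this

theorem kerProj_posSemidef (Q : Mat p₁ p₂) : (kerProj Q).PosSemidef := by
  have := Matrix.posSemidef_conjTranspose_mul_self (kerProj Q)
  rwa [Matrix.conjTranspose_eq_transpose_of_trivial, kerProj_transpose, kerProj_mul_self] at this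

/-- A vector on which both quadratic forms vanish lies in `ker Q` and is annihilated by the
projection onto it. -/
theorem posDef_add_kerProj (hQ : Q.PosSemidef) : (Q + kerProj Q).PosDef := by
  have hS := hQ.add (kerProj_posSemidef Q)
  refine Matrix.PosDef.of_dotProduct_mulVec_pos hS.isHermitian fun x hx => ?_
  refine lt_of_le_of_ne (hS.dotProduct_mulVec_nonneg x) fun h0 => hx ?_
  rw [Matrix.add_mulVec, dotProduct_add] at h0
  have h1 := hQ.dotProduct_mulVec_nonneg x
  have h2 := (kerProj_posSemidef Q).dotProduct_mulVec_nonneg x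
  have h3 := (hQ.dotProduct_mulVec_zero_iff x).1 (by linarith)
  have h4 := ((kerProj_posSemidef Q).dotProduct_mulVec_zero_iff x).1 (by linarith)
  rw [← kerProj_mulVec_eq_self h3, h4]

/-- On `ker Q` the form of `S` is squeezed between `0` and the form of `Q`, so `ker Q` is contained
in `ker S`. -/
theorem mul_kerProj_of_le (hS : S.PosSemidef) (hQS : (Q - S).PosSemidef) :
    S * kerProj Q = 0 := by
  refine mul_kerProj_of_ker_le fun x hx => ?_
  have h1 := hS.dotProduct_mulVec_nonneg x
  have h2 := hQS.dotProduct_mulVec_nonneg x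
  rw [Matrix.sub_mulVec, dotProduct_sub, hx, dotProduct_zero] at h2
  exact (hS.dotProduct_mulVec_zero_iff x).1 (by linarith)

/-- If `B P = 0` for the kernel projection `P`, then the inverse of `B + P` fixes `P`. -/
theorem inv_mul_kerProj {B : Mat p₁ p₂} (h : B * kerProj Q = 0) (hd : (B + kerProj Q).PosDef) :
    (B + kerProj Q)⁻¹ * kerProj Q = kerProj Q := by
  have h1 : (B + kerProj Q) * kerProj Q = kerProj Q := by
    rw [Matrix.add_mul, h, kerProj_mul_self, zero_add]
  have h2 := congrArg ((B + kerProj Q)⁻¹ * ·) h1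
  simpa only [← Matrix.mul_assoc, Matrix.nonsing_inv_mul _ hd.det_pos.ne'.isUnit,
    Matrix.one_mul] using h2.symm

/-- The right side does not depend on `B`; this is what makes the trace terms of `Q` and of the
error covariance cancel later. -/
theorem inv_mul_add_kerProj {B : Mat p₁ p₂} (h : B * kerProj Q = 0)
    (hd : (B + kerProj Q).PosDef) : (B + kerProj Q)⁻¹ * B = 1 - kerProj Q := by
  have h1 := Matrix.nonsing_inv_mul _ hd.det_pos.ne'.isUnit
  rwa [Matrix.mul_add, inv_mul_kerProj h hd, ← eq_sub_iff_add_eq] at h1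

/-- Schur complement criterion for the Loewner order. -/
theorem sub_posSemidef_iff (hQ : Q.PosDef) (hS : S.PosSemidef) :
    (Q - S).PosSemidef ↔ (S - S * Q⁻¹ * S).PosSemidef := by
  have := hQ.isUnit.invertible
  have hb := Matrix.PosDef.fromBlocks₁₁ (A := Q) S S hQ
  rw [hS.isHermitian.eq] at hb
  rw [← hb]
  constructor
  · intro h
    have hh : (Matrix.fromBlocks Q S S S).IsHermitian :=
      Matrix.IsHermitian.fromBlocks hQ.isHermitian hS.isHermitian.eq hS.isHermitian
    refine Matrix.PosSemidef.of_dotProduct_mulVec_nonneg hh fun x => ?_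
    obtain ⟨u, v, rfl⟩ : ∃ u v, x = Sum.elim u v := ⟨_, _, (Sum.elim_comp_inl_inr x).symm⟩
    -- The block form at `(u, v)` is the form of `Q - S` at `u` plus the form of `S` at `u + v`.
    have h1 := h.dotProduct_mulVec_nonneg u
    have h2 := hS.dotProduct_mulVec_nonneg (u + v)
    simp only [star_trivial, Matrix.fromBlocks_mulVec, Matrix.sub_mulVec, Matrix.mulVec_add,
      dotProduct_sub, dotProduct_add, add_dotProduct, Sum.elim_comp_inl, Sum.elim_comp_inr,
      sumElim_dotProduct_sumElim] at h1 h2 ⊢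
    linarith
  · intro h
    refine Matrix.PosSemidef.of_dotProduct_mulVec_nonneg
      (hQ.isHermitian.sub hS.isHermitian) fun x => ?_
    -- On the antidiagonal the block form reduces to that of `Q - S`.
    have h1 := h.dotProduct_mulVec_nonneg (Sum.elim x (-x))
    simp only [star_trivial, Matrix.fromBlocks_mulVec, Matrix.sub_mulVec, Matrix.mulVec_neg,
      dotProduct_sub, dotProduct_add, dotProduct_neg, neg_dotProduct, Sum.elim_comp_inl,
      Sum.elim_comp_inr, sumElim_dotProduct_sumElim] at h1 ⊢
    linarith

/-- With `D = (Q + kerProj Q)⁻¹` in the role of `Q⁻¹`, the formulas `H = 1 - S D` and `QV = S - S D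
S` of the invertible case still work, because `S` vanishes on `ker Q`. -/
theorem exists_realizes (hQ : Q.PosSemidef) (hS : S.PosSemidef) (hQS : (Q - S).PosSemidef) :
    ∃ H QV, Realizes Q H QV S := by
  have hd := posDef_add_kerProj hQ
  have hP := mul_kerProj_of_le hS hQS
  have e1 : (Q + kerProj Q)⁻¹ * Q = 1 - kerProj Q := inv_mul_add_kerProj (mul_kerProj Q) hd
  set D := (Q + kerProj Q)⁻¹ with hD
  have hDt : Dᵀ = D := hd.inv.posSemidef.transpose_eq
  have e2 : Q * D = 1 - kerProj Q := by
    have := congrArg Matrix.transpose e1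
    rwa [Matrix.transpose_mul, hQ.transpose_eq, hDt, Matrix.transpose_sub, kerProj_transpose,
      Matrix.transpose_one] at this
  have hH : (1 - S * D) * Q = Q - S := by
    rw [Matrix.sub_mul, Matrix.mul_assoc, e1, Matrix.mul_sub, hP]; simp
  have hHt : Q * (1 - S * D)ᵀ = Q - S := by
    have := congrArg Matrix.transpose hH
    rwa [Matrix.transpose_mul, hQ.transpose_eq, hQS.transpose_eq] at this
  have hN : (1 - S * D) * Q - (1 - S * D) * Q * (1 - S * D)ᵀ = S - S * D * S := by
    rw [hH, Matrix.transpose_sub, Matrix.transpose_mul, hDt, hS.transpose_eq, Matrix.transpose_one,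
      Matrix.mul_sub, Matrix.sub_mul Q S (D * S), ← Matrix.mul_assoc Q, e2, Matrix.sub_mul 1,
      kerProj_mul_of_mul_kerProj hS.transpose_eq hP, ← Matrix.mul_assoc]
    simp
  refine ⟨1 - S * D, S - S * D * S, hH, hHt.symm, hH ▸ hQS, hN.symm, ?_⟩
  refine (sub_posSemidef_iff hd hS).1 ?_
  rw [add_sub_right_comm]
  exact hQS.add (kerProj_posSemidef Q)

variable {H QV : Mat p₁ p₂}

theorem Realizes.sub_posSemidef (h : Realizes Q H QV S) : (Q - S).PosSemidef :=
  h.left_eq ▸ h.posSemidef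

/-- `S` is the covariance of `X - X̂ = (1 - H) X - V`, namely `(1 - H) Q (1 - H)ᵀ + QV`. -/
theorem Realizes.cov_posSemidef (hQ : Q.PosSemidef) (h : Realizes Q H QV S) : S.PosSemidef := by
  have h1 := hQ.mul_mul_conjTranspose_same (1 - H)
  have h2 : S = (1 - H) * Q * (1 - H)ᴴ + QV := by
    have e : S = Q - H * Q := by rw [h.left_eq]; simp
    have e' : H * Q = Q * Hᵀ := h.left_eq.trans h.right_eq
    rw [h.noise_eq, e, Matrix.conjTranspose_eq_transpose_of_trivial, Matrix.transpose_sub,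
      Matrix.transpose_one, Matrix.sub_mul, Matrix.one_mul, Matrix.sub_mul, Matrix.mul_sub,
      Matrix.mul_sub, Matrix.mul_one, Matrix.mul_one, ← e']
    abel
  rw [h2]
  exact h1.add h.noise_posSemidef

theorem constraintSet_eq_constraintSetPD (hQ : Q.PosSemidef) (Δ₁ Δ₂ : ℝ) :
    constraintSet Q Δ₁ Δ₂ = constraintSetPD Q Δ₁ Δ₂ := by
  ext S
  constructor
  · rintro ⟨⟨H, QV, h⟩, ht⟩
    exact ⟨h.sub_posSemidef, h.cov_posSemidef hQ, ht⟩
  · rintro ⟨h1, h2, ht⟩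
    exact ⟨exists_realizes hQ h2 h1, ht⟩

theorem Realizes.eq_of_posDef (hQ : Q.PosDef) (h : Realizes Q H QV S) :
    H = 1 - S * Q⁻¹ ∧ QV = S - S * Q⁻¹ * S := by
  have hS := h.cov_posSemidef hQ.posSemidef
  have hu := hQ.det_pos.ne'.isUnit
  have e1 : H = 1 - S * Q⁻¹ := by
    have := congrArg (· * Q⁻¹) h.left_eq
    simpa [Matrix.mul_assoc, Matrix.mul_nonsing_inv Q hu, Matrix.sub_mul] using this
  refine ⟨e1, ?_⟩
  have e3 : Hᵀ = 1 - Q⁻¹ * S := by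
    rw [e1, Matrix.transpose_sub, Matrix.transpose_mul, hS.transpose_eq,
      hQ.inv.posSemidef.transpose_eq, Matrix.transpose_one]
  rw [h.noise_eq, h.left_eq, e3, Matrix.mul_sub, Matrix.sub_mul Q S (Q⁻¹ * S), ← Matrix.mul_assoc Q,
    Matrix.mul_nonsing_inv Q hu, ← Matrix.mul_assoc]
  simp

theorem isClosed_posSemidef : IsClosed {A : Mat p₁ p₂ | A.PosSemidef} := by
  have : {A : Mat p₁ p₂ | A.PosSemidef} =
      {A | Aᴴ = A} ∩ ⋂ x : Idx p₁ p₂ → ℝ, {A | 0 ≤ star x ⬝ᵥ (A *ᵥ x)} := by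
    ext A
    simp only [Matrix.posSemidef_iff_dotProduct_mulVec, Set.mem_ofPred_eq, Set.mem_inter_iff,
      Set.mem_iInter]
    rfl
  rw [this]
  refine (isClosed_eq (by fun_prop) (by fun_prop)).inter (isClosed_iInter fun x => ?_)
  exact isClosed_le (by fun_prop) (by fun_prop)

/-- The test vectors `eᵢ ± eⱼ` give `2 |A i j| ≤ A i i + A j j`. The bound makes the constraint set
bounded, since `S ⪯ Q` bounds the trace of `S`. -/
theorem _root_.Matrix.PosSemidef.abs_apply_le_trace {n : Type*} [Fintype n] [DecidableEq n]
    {A : Matrix n n ℝ} (h : A.PosSemidef) (i j : n) : |A i j| ≤ A.trace := by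
  have hs : A j i = A i j := congrFun (congrFun h.transpose_eq i) j
  have key : ∀ c : ℝ, 0 ≤ A i i + 2 * c * A i j + c ^ 2 * A j j := by
    intro c
    have := h.dotProduct_mulVec_nonneg (Pi.single i 1 + c • Pi.single j 1)
    simp [Matrix.mulVec_add, Matrix.mulVec_smul, dotProduct_add, add_dotProduct, hs] at this
    linarith
  have h1 := key 1
  have h2 := key (-1)
  have hi : ∀ k, A k k ≤ A.trace := fun k =>
    Finset.single_le_sum (f := fun k => A k k) (fun k _ => h.diag_nonneg) (Finset.mem_univ k)
  have := hi i
  have := hi j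
  rw [abs_le]
  constructor <;> linarith

theorem isCompact_constraintSetPD (Q : Mat p₁ p₂) (Δ₁ Δ₂ : ℝ) :
    IsCompact (constraintSetPD Q Δ₁ Δ₂) := by
  have hcl : IsClosed (constraintSetPD Q Δ₁ Δ₂) := by
    have : constraintSetPD Q Δ₁ Δ₂ = (fun S => Q - S) ⁻¹' {A : Mat p₁ p₂ | A.PosSemidef} ∩
        ({A : Mat p₁ p₂ | A.PosSemidef} ∩ ({S | S.toBlocks₁₁.trace ≤ Δ₁} ∩
          {S | S.toBlocks₂₂.trace ≤ Δ₂})) := rfl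
    rw [this]
    refine (isClosed_posSemidef.preimage (by fun_prop)).inter (isClosed_posSemidef.inter
      (IsClosed.inter (isClosed_le ?_ (by fun_prop)) (isClosed_le ?_ (by fun_prop))))
    · simp only [Matrix.trace, Matrix.toBlocks₁₁, Matrix.diag, Matrix.of_apply]
      fun_prop
    · simp only [Matrix.trace, Matrix.toBlocks₂₂, Matrix.diag, Matrix.of_apply]
      fun_prop
  have hcpt : IsCompact (Set.pi Set.univ fun _ : Idx p₁ p₂ =>
      Set.pi Set.univ fun _ : Idx p₁ p₂ => Set.Icc (-Q.trace) Q.trace) :=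
    isCompact_univ_pi fun _ => isCompact_univ_pi fun _ => isCompact_Icc
  refine IsCompact.of_isClosed_subset hcpt hcl ?_
  rintro S ⟨h1, h2, -⟩ i - j -
  have h3 := abs_le.1 (h2.abs_apply_le_trace i j)
  have h4 := h1.trace_nonneg
  rw [Matrix.trace_sub] at h4
  exact ⟨by linarith, by linarith⟩

theorem constraintSetPD_nonempty (hQ : Q.PosSemidef) {Δ₁ Δ₂ : ℝ} (h₁ : 0 ≤ Δ₁) (h₂ : 0 ≤ Δ₂) :
    (constraintSetPD Q Δ₁ Δ₂).Nonempty :=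
  ⟨0, by simpa using hQ, Matrix.PosSemidef.zero, by
    constructor <;> simpa [Matrix.trace, Matrix.toBlocks₁₁, Matrix.toBlocks₂₂]⟩

theorem halfLogRatio_anti {a b c : ℝ} (ha : 0 < a) (h : b ≤ c) :
    halfLogRatio a c ≤ halfLogRatio a b := by
  unfold halfLogRatio
  split_ifs with hc hb hb
  · exact_mod_cast mul_le_mul_of_nonneg_left (Real.log_le_log (div_pos ha hc)
      (div_le_div_of_nonneg_left ha.le hb h)) (by norm_num)
  · exact le_top
  · exact absurd (hb.trans_le h) hc
  · exact le_rfl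

/-- The rate is minimized over the constraint set. -/
theorem exists_rate_minimizer (hQ : Q.PosSemidef) {Δ₁ Δ₂ : ℝ} (h₁ : 0 ≤ Δ₁) (h₂ : 0 ≤ Δ₂) :
    ∃ S ∈ constraintSetPD Q Δ₁ Δ₂, ∀ T ∈ constraintSetPD Q Δ₁ Δ₂, rate Q S ≤ rate Q T := by
  -- The determinant is maximized instead of minimizing the rate: it is continuous everywhere,
  -- including where the rate is infinite.
  obtain ⟨S, hS, hm⟩ := (isCompact_constraintSetPD Q Δ₁ Δ₂).exists_isMaxOn
    (constraintSetPD_nonempty hQ h₁ h₂) (f := fun S : Mat p₁ p₂ => (S + kerProj Q).det)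
    (by fun_prop)
  exact ⟨S, hS, fun T hT => halfLogRatio_anti (posDef_add_kerProj hQ).det_pos (hm hT)⟩

end MatrixFacts

/-! ### Gaussian densities -/

section Density

theorem map_withDensity_comp {α β : Type*} [MeasurableSpace α] [MeasurableSpace β]
    {μ : Measure α} {φ : α → β} (hφ : Measurable φ) {k : β → ℝ≥0∞} (hk : Measurable k) :
    (μ.withDensity (k ∘ φ)).map φ = (μ.map φ).withDensity k := by
  ext s hs
  rw [Measure.map_apply hφ hs, withDensity_apply _ (hφ hs), withDensity_apply _ hs,
    setLIntegral_map hs hk hφ]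
  rfl

open Complex in
-- Both sides have the same characteristic function. The constant is left implicit, because only
-- ratios of Gaussian densities are used.
theorem exists_stdGaussian_eq_withDensity (E : Type*) [NormedAddCommGroup E]
    [InnerProductSpace ℝ E] [FiniteDimensional ℝ E] [MeasurableSpace E] [BorelSpace E] :
    ∃ c : ℝ, 0 < c ∧ stdGaussian E =
      (volume : Measure E).withDensity fun x => ENNReal.ofReal (c * Real.exp (-(‖x‖ ^ 2) / 2)) := by
  have hint : Integrable (fun x : E => Real.exp (-(‖x‖ ^ 2) / 2)) := by
    have := (GaussianFourier.integrable_cexp_neg_mul_sq_norm_add (V := E) (b := 1 / 2)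
      (by norm_num) 0 0).norm
    refine this.congr (ae_of_all _ fun x => ?_)
    simp only [Complex.norm_exp]
    congr 1
    simp [← Complex.ofReal_pow]
    ring
  have key : ∀ w : E, ∫ x : E, cexp (-(‖x‖ ^ 2) / 2) * cexp (inner ℝ x w * I) =
      (∫ x : E, cexp (-(‖x‖ ^ 2) / 2)) * cexp (-(‖w‖ ^ 2) / 2) := by
    intro w
    have h1 := GaussianFourier.integral_cexp_neg_mul_sq_norm_add (V := E) (b := 1 / 2)
      (by norm_num) I w
    have h2 := GaussianFourier.integral_cexp_neg_mul_sq_norm_add (V := E) (b := 1 / 2)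
      (by norm_num) 0 0
    simp only [zero_mul, add_zero, inner_zero_left] at h2
    have e1 : ∀ x : E, cexp (-(‖x‖ ^ 2) / 2) * cexp (inner ℝ x w * I) =
        cexp (-(1 / 2) * ‖x‖ ^ 2 + I * inner ℝ w x) := by
      intro x
      rw [← Complex.exp_add, real_inner_comm]
      ring_nf
    have e2 : ∀ x : E, cexp (-(‖x‖ ^ 2) / 2) = cexp (-(1 / 2) * ‖x‖ ^ 2) := by
      intro x
      ring_nf
    simp_rw [e1, e2, h1, h2]
    simp only [I_sq]
    norm_num
    ring_nf
  set Z : ℝ := ∫ x : E, Real.exp (-(‖x‖ ^ 2) / 2) with hZ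
  have hZpos : 0 < Z := integral_exp_pos hint
  have hZc : ∫ x : E, cexp (-(‖x‖ ^ 2) / 2) = Z := by
    rw [hZ, ← integral_complex_ofReal]
    congr 1
    ext x
    push_cast
    rfl
  refine ⟨Z⁻¹, inv_pos.2 hZpos, ?_⟩
  have hfin : IsFiniteMeasure ((volume : Measure E).withDensity fun x =>
      ENNReal.ofReal (Z⁻¹ * Real.exp (-(‖x‖ ^ 2) / 2))) :=
    isFiniteMeasure_withDensity_ofReal (hint.const_mul _).2
  refine Measure.ext_of_charFun ?_
  ext w
  rw [charFun_stdGaussian, charFun_apply, integral_withDensity_eq_integral_toReal_smul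
    (by fun_prop) (ae_of_all _ fun _ => ENNReal.ofReal_lt_top)]
  have e3 : ∀ x : E, (ENNReal.ofReal (Z⁻¹ * Real.exp (-(‖x‖ ^ 2) / 2))).toReal •
      cexp (inner ℝ x w * I) = (Z : ℂ)⁻¹ * (cexp (-(‖x‖ ^ 2) / 2) * cexp (inner ℝ x w * I)) := by
    intro x
    rw [ENNReal.toReal_ofReal (by positivity), Complex.real_smul]
    push_cast
    ring
  simp_rw [e3]
  rw [integral_const_mul, key, hZc, ← mul_assoc, inv_mul_cancel₀ (by exact_mod_cast hZpos.ne'),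
    one_mul]

variable {ι : Type*} [Fintype ι] [DecidableEq ι]

open scoped MatrixOrder in
theorem _root_.Matrix.PosDef.sqrt_facts {M : Matrix ι ι ℝ} (hM : M.PosDef) :
    (CFC.sqrt M)ᵀ = CFC.sqrt M ∧ CFC.sqrt M * CFC.sqrt M = M ∧ IsUnit (CFC.sqrt M).det ∧
      |(CFC.sqrt M).det| = √M.det := by
  have h1 : CFC.sqrt M * CFC.sqrt M = M := CFC.sqrt_mul_sqrt_self M hM.posSemidef.nonneg
  have h2 : (CFC.sqrt M).PosSemidef := Matrix.nonneg_iff_posSemidef.1 (CFC.sqrt_nonneg M)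
  have h3 : (CFC.sqrt M).det * (CFC.sqrt M).det = M.det := by rw [← Matrix.det_mul, h1]
  refine ⟨h2.transpose_eq, h1, isUnit_iff_ne_zero.2 fun h => ?_, ?_⟩
  · rw [h, zero_mul] at h3
    exact hM.det_pos.ne h3
  · rw [← h3, Real.sqrt_mul_self_eq_abs]

open scoped MatrixOrder in
/-- The Lebesgue density of a nondegenerate Gaussian measure, up to a constant that does not
depend on the mean and the covariance. -/
theorem exists_multivariateGaussian_eq_withDensity (ι : Type*) [Fintype ι] [DecidableEq ι] :
    ∃ c : ℝ, 0 < c ∧ ∀ (m : EuclideanSpace ℝ ι) (M : Matrix ι ι ℝ), M.PosDef →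
      multivariateGaussian m M = (volume : Measure (EuclideanSpace ℝ ι)).withDensity fun x =>
        ENNReal.ofReal (c / √M.det *
          Real.exp (-((x - m).ofLp ⬝ᵥ M⁻¹ *ᵥ (x - m).ofLp) / 2)) := by
  obtain ⟨c, hc, hstd⟩ := exists_stdGaussian_eq_withDensity (EuclideanSpace ℝ ι)
  refine ⟨c, hc, fun m M hM => ?_⟩
  obtain ⟨ht, hmul, hu, hdet⟩ := hM.sqrt_facts
  set L := CFC.sqrt M with hL
  set φ : EuclideanSpace ℝ ι → EuclideanSpace ℝ ι :=
    fun x => m + Matrix.toEuclideanCLM (𝕜 := ℝ) L x with hφ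
  set k : EuclideanSpace ℝ ι → ℝ≥0∞ := fun x =>
    ENNReal.ofReal (c * Real.exp (-((x - m).ofLp ⬝ᵥ M⁻¹ *ᵥ (x - m).ofLp) / 2)) with hk
  have hkm : Measurable k := by
    have : Continuous fun x : EuclideanSpace ℝ ι => (x - m).ofLp ⬝ᵥ M⁻¹ *ᵥ (x - m).ofLp := by
      fun_prop
    exact (ENNReal.continuous_ofReal.comp (continuous_const.mul (Real.continuous_exp.comp
      (this.neg.div_const 2)))).measurable
  have hφm : Measurable φ := by fun_prop
  -- The substitution `x ↦ m + L x` with `L * L = M` turns the quadratic form of `M⁻¹` into `‖x‖ ^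
  -- 2`; its Jacobian supplies the factor `(√M.det)⁻¹`.
  have hcomp : (fun x : EuclideanSpace ℝ ι =>
      ENNReal.ofReal (c * Real.exp (-(‖x‖ ^ 2) / 2))) = k ∘ φ := by
    ext x
    simp only [hk, hφ, Function.comp_apply, add_sub_cancel_left, Matrix.ofLp_toEuclideanCLM]
    have : L *ᵥ x.ofLp ⬝ᵥ M⁻¹ *ᵥ (L *ᵥ x.ofLp) = ‖x‖ ^ 2 := by
      rw [Matrix.mulVec_mulVec, ← hmul, Matrix.mul_inv_rev, Matrix.mul_assoc,
        Matrix.nonsing_inv_mul _ hu, Matrix.mul_one, Matrix.dotProduct_mulVec,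
        ← Matrix.mulVec_transpose, Matrix.transpose_nonsing_inv, ht, Matrix.mulVec_mulVec,
        Matrix.nonsing_inv_mul _ hu, Matrix.one_mulVec, EuclideanSpace.real_norm_sq_eq]
      simp [dotProduct, sq]
    rw [this]
  have hvol : (volume : Measure (EuclideanSpace ℝ ι)).map φ =
      ENNReal.ofReal (√M.det)⁻¹ • volume := by
    have h1 : φ = (fun x => m + x) ∘ Matrix.toEuclideanLin L := rfl
    have hd : LinearMap.det (Matrix.toEuclideanLin L) = L.det :=
      LinearMap.det_toLin (PiLp.basisFun 2 ℝ ι) L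
    rw [h1, ← Measure.map_map (by fun_prop)
      (LinearMap.continuous_of_finiteDimensional _).measurable,
      Measure.map_linearMap_addHaar_eq_smul_addHaar _ (by rw [hd]; exact hu.ne_zero),
      Measure.map_smul, map_add_left_eq_self, hd, abs_inv, hdet]
  rw [multivariateGaussian, hstd, hcomp, map_withDensity_comp hφm hkm, hvol,
    withDensity_smul_measure, ← withDensity_smul _ hkm]
  congr 1
  ext x
  simp only [hk, Pi.smul_apply, smul_eq_mul]
  rw [← ENNReal.ofReal_mul (by positivity)]
  congr 1
  ring

/-- The logarithm of the density of `G(m, M)` with respect to `G(0, Q)`. -/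
def gaussianLLR (Q M : Matrix ι ι ℝ) (x m : EuclideanSpace ℝ ι) : ℝ :=
  1 / 2 * Real.log (Q.det / M.det) - (x - m).ofLp ⬝ᵥ M⁻¹ *ᵥ (x - m).ofLp / 2 +
    x.ofLp ⬝ᵥ Q⁻¹ *ᵥ x.ofLp / 2

theorem continuous_gaussianLLR (Q M : Matrix ι ι ℝ) :
    Continuous fun z : EuclideanSpace ℝ ι × EuclideanSpace ℝ ι => gaussianLLR Q M z.1 z.2 := by
  unfold gaussianLLR
  fun_prop

theorem continuous_gaussianLLR_left (Q M : Matrix ι ι ℝ) (m : EuclideanSpace ℝ ι) :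
    Continuous fun x => gaussianLLR Q M x m := by
  unfold gaussianLLR
  fun_prop

/-- Quotient of the two Lebesgue densities, in which the unknown constant cancels. -/
theorem multivariateGaussian_eq_withDensity {Q M : Matrix ι ι ℝ} (hQ : Q.PosDef) (hM : M.PosDef)
    (m : EuclideanSpace ℝ ι) :
    multivariateGaussian m M = (multivariateGaussian 0 Q).withDensity fun x =>
      ENNReal.ofReal (Real.exp (gaussianLLR Q M x m)) := by
  obtain ⟨c, hc, h⟩ := exists_multivariateGaussian_eq_withDensity ι
  have hf := continuous_gaussianLLR_left Q M m
  have hm1 : Measurable fun x : EuclideanSpace ℝ ι => ENNReal.ofReal (c / √Q.det *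
      Real.exp (-((x - 0).ofLp ⬝ᵥ Q⁻¹ *ᵥ (x - 0).ofLp) / 2)) := by
    have : Continuous fun x : EuclideanSpace ℝ ι => (x - 0).ofLp ⬝ᵥ Q⁻¹ *ᵥ (x - 0).ofLp := by
      fun_prop
    exact (ENNReal.continuous_ofReal.comp (continuous_const.mul (Real.continuous_exp.comp
      (this.neg.div_const 2)))).measurable
  have hm2 : Measurable fun x => ENNReal.ofReal (Real.exp (gaussianLLR Q M x m)) :=
    (ENNReal.continuous_ofReal.comp (Real.continuous_exp.comp hf)).measurable
  rw [h m M hM, h 0 Q hQ, ← withDensity_mul _ hm1 hm2]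
  · congr 1
    ext x
    have hdQ := hQ.det_pos
    have hdM := hM.det_pos
    simp only [Pi.mul_apply]
    rw [← ENNReal.ofReal_mul (by positivity), mul_assoc, ← Real.exp_add, gaussianLLR, sub_zero]
    have e : Real.exp (1 / 2 * Real.log (Q.det / M.det)) = √Q.det / √M.det := by
      rw [one_div_mul_eq_div, ← Real.log_sqrt (by positivity), Real.exp_log (by positivity),
        Real.sqrt_div hdQ.le]
    congr 1
    rw [show -(x.ofLp ⬝ᵥ Q⁻¹ *ᵥ x.ofLp) / 2 + (1 / 2 * Real.log (Q.det / M.det) -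
      (x - m).ofLp ⬝ᵥ M⁻¹ *ᵥ (x - m).ofLp / 2 + x.ofLp ⬝ᵥ Q⁻¹ *ᵥ x.ofLp / 2) =
      1 / 2 * Real.log (Q.det / M.det) + -((x - m).ofLp ⬝ᵥ M⁻¹ *ᵥ (x - m).ofLp) / 2 by ring,
      Real.exp_add, e, ← mul_assoc]
    congr 1
    field_simp

theorem multivariateGaussian_map {S : Matrix ι ι ℝ} (hS : S.PosSemidef)
    (m : EuclideanSpace ℝ ι) (A : Matrix ι ι ℝ) :
    (multivariateGaussian m S).map (Matrix.toEuclideanCLM (𝕜 := ℝ) A) =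
      multivariateGaussian (Matrix.toEuclideanCLM (𝕜 := ℝ) A m) (A * S * Aᵀ) := by
  have hS' : (A * S * Aᵀ).PosSemidef := by
    rw [← Matrix.conjTranspose_eq_transpose_of_trivial]
    exact hS.mul_mul_conjTranspose_same A
  apply IsGaussian.ext
  · simp only [id_eq, integral_id_multivariateGaussian]
    rw [ContinuousLinearMap.integral_id_map IsGaussian.integrable_id,
      integral_id_multivariateGaussian]
  · ext x y
    rw [covarianceBilin_map IsGaussian.memLp_two_id, covarianceBilin_multivariateGaussian hS,
      covarianceBilin_multivariateGaussian hS']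
    have h (z : EuclideanSpace ℝ ι) : (ContinuousLinearMap.adjoint
        (Matrix.toEuclideanCLM (𝕜 := ℝ) A) z).ofLp = Aᵀ *ᵥ z.ofLp := by
      rw [← ContinuousLinearMap.star_eq_adjoint,
        ← map_star (Matrix.toEuclideanCLM (n := ι) (𝕜 := ℝ)), Matrix.ofLp_toEuclideanCLM,
        Matrix.star_eq_conjTranspose, Matrix.conjTranspose_eq_transpose_of_trivial]
    rw [h, h, Matrix.mulVec_mulVec, Matrix.mulVec_transpose, ← Matrix.dotProduct_mulVec,
      Matrix.mulVec_mulVec, Matrix.mul_assoc]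

end Density

/-! ### Densities between degenerate Gaussian laws -/

section Singular

variable {p₁ p₂ : ℕ} {Q S : Mat p₁ p₂}

/-- Both inverses fix `P = kerProj Q`, so removing the kernel component of `x` subtracts the same
amount `x ⬝ᵥ P *ᵥ x` from each quadratic form, and the two forms enter with opposite signs. -/
theorem gaussianLLR_proj (hQ : Q.PosSemidef) (hSP : S * kerProj Q = 0)
    (hd : (S + kerProj Q).PosDef) {m : Vec p₁ p₂} (hm : kerProj Q *ᵥ m.ofLp = 0)
    (x : Vec p₁ p₂) :
    gaussianLLR (Q + kerProj Q) (S + kerProj Q)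
        (Matrix.toEuclideanCLM (𝕜 := ℝ) (1 - kerProj Q) x) m =
      gaussianLLR (Q + kerProj Q) (S + kerProj Q) x m := by
  set P := kerProj Q with hP
  have key : ∀ (B : Mat p₁ p₂) (u w : Idx p₁ p₂ → ℝ), Bᵀ = B → B * P = P → P *ᵥ w = 0 →
      (u - P *ᵥ u - w) ⬝ᵥ B *ᵥ (u - P *ᵥ u - w) =
        (u - w) ⬝ᵥ B *ᵥ (u - w) - u ⬝ᵥ P *ᵥ u := by
    intro B u w hB hBP hw
    have hPP : P * P = P := kerProj_mul_self Q
    have hPB : P * B = P := by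
      have := congrArg Matrix.transpose hBP
      rwa [Matrix.transpose_mul, hB, kerProj_transpose] at this
    have e1 : ∀ v v' : Idx p₁ p₂ → ℝ, P *ᵥ v ⬝ᵥ v' = v ⬝ᵥ P *ᵥ v' := by
      intro v v'
      rw [Matrix.dotProduct_mulVec, ← Matrix.mulVec_transpose, kerProj_transpose]
    simp only [Matrix.mulVec_sub, dotProduct_sub, sub_dotProduct, e1, Matrix.mulVec_mulVec, hBP,
      hPB, hPP, hw, dotProduct_zero]
    have e2 : w ⬝ᵥ P *ᵥ u = 0 := by rw [← e1, hw, zero_dotProduct]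
    rw [e2]
    ring
  have hQd := posDef_add_kerProj hQ
  have k1 := key (S + P)⁻¹ x.ofLp m.ofLp hd.inv.posSemidef.transpose_eq (inv_mul_kerProj hSP hd) hm
  have k2 := key (Q + P)⁻¹ x.ofLp 0 hQd.inv.posSemidef.transpose_eq
    (inv_mul_kerProj (mul_kerProj Q) hQd) (Matrix.mulVec_zero _)
  simp only [sub_zero] at k2
  simp only [gaussianLLR, WithLp.ofLp_sub, Matrix.ofLp_toEuclideanCLM, Matrix.sub_mulVec,
    Matrix.one_mulVec, k1, k2]
  ring

/-- The density of `G(m, S)` with respect to the possibly degenerate `G(0, Q)`, when `S` has the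
same range as `Q` and `m` lies in this range. -/
theorem multivariateGaussian_eq_gaussian_withDensity (hQ : Q.PosSemidef) (hS : S.PosSemidef)
    (hSP : S * kerProj Q = 0) (hd : (S + kerProj Q).PosDef) {m : Vec p₁ p₂}
    (hm : kerProj Q *ᵥ m.ofLp = 0) :
    multivariateGaussian m S = (gaussian Q).withDensity fun x =>
      ENNReal.ofReal (Real.exp (gaussianLLR (Q + kerProj Q) (S + kerProj Q) x m)) := by
  -- Both degenerate laws are images under `1 - kerProj Q` of nondegenerate ones. The density
  -- between the latter is invariant under this projection, so it passes to the images unchanged.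
  have hcov : ∀ {B : Mat p₁ p₂}, Bᵀ = B → B * kerProj Q = 0 →
      (1 - kerProj Q) * (B + kerProj Q) * (1 - kerProj Q)ᵀ = B := by
    intro B hB hBP
    have hPB := kerProj_mul_of_mul_kerProj hB hBP
    rw [Matrix.transpose_sub, Matrix.transpose_one, kerProj_transpose]
    simp [Matrix.sub_mul, Matrix.mul_sub, Matrix.mul_add, hBP, hPB,
      kerProj_mul_self]
  have hQd := posDef_add_kerProj hQ
  have h1 := multivariateGaussian_map hd.posSemidef m (1 - kerProj Q)
  rw [hcov hS.transpose_eq hSP] at h1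
  have hm' : Matrix.toEuclideanCLM (𝕜 := ℝ) (1 - kerProj Q) m = m := by
    apply WithLp.ofLp_injective 2
    rw [Matrix.ofLp_toEuclideanCLM, Matrix.sub_mulVec, hm, Matrix.one_mulVec, sub_zero]
  have h2 := multivariateGaussian_map hQd.posSemidef 0 (1 - kerProj Q)
  rw [hcov hQ.transpose_eq (mul_kerProj Q), map_zero] at h2
  rw [hm'] at h1
  have hf := continuous_gaussianLLR_left (Q + kerProj Q) (S + kerProj Q) m
  have hfm : Measurable fun x => ENNReal.ofReal (Real.exp
      (gaussianLLR (Q + kerProj Q) (S + kerProj Q) x m)) :=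
    (ENNReal.continuous_ofReal.comp (Real.continuous_exp.comp hf)).measurable
  have hcomp : (fun x => ENNReal.ofReal (Real.exp
      (gaussianLLR (Q + kerProj Q) (S + kerProj Q) x m))) = (fun x => ENNReal.ofReal (Real.exp
      (gaussianLLR (Q + kerProj Q) (S + kerProj Q) x m))) ∘
      Matrix.toEuclideanCLM (𝕜 := ℝ) (1 - kerProj Q) := by
    ext x
    rw [Function.comp_apply, gaussianLLR_proj hQ hSP hd hm]
  rw [gaussian, ← h2, ← h1, multivariateGaussian_eq_withDensity hQd hd, hcomp,
    map_withDensity_comp (ContinuousLinearMap.continuous _).measurable hfm, ← hcomp]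

end Singular

/-! ### Divergence bounds -/

section Divergence

variable {α : Type*} [MeasurableSpace α] {μ ν : Measure α} {f : α → ℝ}

/-- The Donsker-Varadhan lower bound for a normalized exponential. -/
theorem integral_le_klDiv [IsProbabilityMeasure μ] [IsProbabilityMeasure ν] (hfm : Measurable f)
    (hf : Integrable f μ) (h1 : ∫⁻ x, ENNReal.ofReal (Real.exp (f x)) ∂ν = 1) :
    ((∫ x, f x ∂μ : ℝ) : EReal) ≤ (InformationTheory.klDiv μ ν : EReal) := by
  by_cases hfin : InformationTheory.klDiv μ ν = ⊤
  · simp [hfin]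
  obtain ⟨hac, hint⟩ := InformationTheory.klDiv_ne_top_iff.1 hfin
  have hexp : Integrable (fun x => Real.exp (f x)) ν := by
    refine ⟨by fun_prop, ?_⟩
    rw [hasFiniteIntegral_iff_ofReal (ae_of_all _ fun x => (Real.exp_pos _).le), h1]
    exact ENNReal.one_lt_top
  have hone : ∫ x, Real.exp (f x) ∂ν = 1 := by
    rw [integral_eq_lintegral_of_nonneg_ae (ae_of_all _ fun x => (Real.exp_pos _).le)
      (by fun_prop), h1, ENNReal.toReal_one]
  -- The divergence of `μ` from the tilted measure is that from `ν`, minus `∫ f ∂μ`, plus the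
  -- log-normalizer, which is `0` here; its nonnegativity is the claim.
  have hprob : IsProbabilityMeasure (ν.tilted f) := isProbabilityMeasure_tilted hexp
  have hac' : μ ≪ ν.tilted f := hac.trans (absolutelyContinuous_tilted hexp)
  have hll := integral_llr_tilted_right hac hf hexp hint
  have hnn := InformationTheory.toReal_klDiv_of_measure_eq hac' (by simp)
  rw [hll, hone, Real.log_one, add_zero, ← InformationTheory.toReal_klDiv_of_measure_eq hac
    (by simp)] at hnn
  have hle : ∫ x, f x ∂μ ≤ (InformationTheory.klDiv μ ν).toReal := by
    have : 0 ≤ (InformationTheory.klDiv μ (ν.tilted f)).toReal := ENNReal.toReal_nonneg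
    linarith
  rw [← EReal.coe_ennreal_toReal hfin]
  exact_mod_cast hle

theorem klDiv_eq_integral_of_withDensity_exp [IsProbabilityMeasure μ] [IsProbabilityMeasure ν]
    (hfm : Measurable f) (hf : Integrable f μ)
    (h : μ = ν.withDensity fun x => ENNReal.ofReal (Real.exp (f x))) :
    (InformationTheory.klDiv μ ν : EReal) = ((∫ x, f x ∂μ : ℝ) : EReal) := by
  have hac : μ ≪ ν := h ▸ withDensity_absolutelyContinuous _ _
  have hll : llr μ ν =ᵐ[μ] f := by
    have h2 : μ.rnDeriv ν =ᵐ[ν] fun x => ENNReal.ofReal (Real.exp (f x)) := by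
      conv_lhs => rw [h]
      exact Measure.rnDeriv_withDensity ν (by fun_prop)
    filter_upwards [hac.ae_le h2] with x hx
    rw [llr, hx, ENNReal.toReal_ofReal (Real.exp_pos _).le, Real.log_exp]
  have hint : Integrable (llr μ ν) μ := hf.congr hll.symm
  rw [← EReal.coe_ennreal_toReal (InformationTheory.klDiv_ne_top hac hint),
    InformationTheory.toReal_klDiv_of_measure_eq hac (by simp), integral_congr_ae hll]

end Divergence

/-! ### Second moments -/

section SecondMoments

variable {Ω ι : Type*} [MeasurableSpace Ω] {π : Measure Ω}

/-- The coordinates of a random vector are square integrable. -/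
def SqIntegrable (u : Ω → ι → ℝ) (π : Measure Ω) : Prop := ∀ i, MemLp (fun ω => u ω i) 2 π

/-- The matrix `E[u vᵀ]`. -/
def crossMoment (π : Measure Ω) (u v : Ω → ι → ℝ) : Matrix ι ι ℝ :=
  Matrix.of fun i j => ∫ ω, u ω i * v ω j ∂π

variable {u u' v v' : Ω → ι → ℝ}

theorem SqIntegrable.integrable_mul (hu : SqIntegrable u π) (hv : SqIntegrable v π) (i j : ι) :
    Integrable (fun ω => u ω i * v ω j) π :=
  (hu i).integrable_mul (hv j)

theorem SqIntegrable.sub (hu : SqIntegrable u π) (hv : SqIntegrable v π) :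
    SqIntegrable (fun ω => u ω - v ω) π :=
  fun i => (hu i).sub (hv i)

theorem SqIntegrable.mulVec [Fintype ι] (hu : SqIntegrable u π) (A : Matrix ι ι ℝ) :
    SqIntegrable (fun ω => A *ᵥ u ω) π :=
  fun i => memLp_finsetSum _ fun j _ => (hu j).const_mul (A i j)

theorem crossMoment_transpose (π : Measure Ω) (u v : Ω → ι → ℝ) :
    (crossMoment π u v)ᵀ = crossMoment π v u := by
  ext i j
  simp [crossMoment, mul_comm]

theorem crossMoment_sub_left (hu : SqIntegrable u π) (hu' : SqIntegrable u' π)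
    (hv : SqIntegrable v π) :
    crossMoment π (fun ω => u ω - u' ω) v = crossMoment π u v - crossMoment π u' v := by
  ext i j
  simp only [crossMoment, Matrix.of_apply, Matrix.sub_apply, Pi.sub_apply, sub_mul]
  exact integral_sub (hu.integrable_mul hv i j) (hu'.integrable_mul hv i j)

theorem crossMoment_sub_right (hu : SqIntegrable u π) (hv : SqIntegrable v π)
    (hv' : SqIntegrable v' π) :
    crossMoment π u (fun ω => v ω - v' ω) = crossMoment π u v - crossMoment π u v' := by
  rw [← crossMoment_transpose, crossMoment_sub_left hv hv' hu, Matrix.transpose_sub,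
    crossMoment_transpose, crossMoment_transpose]

theorem crossMoment_add_left (hu : SqIntegrable u π) (hu' : SqIntegrable u' π)
    (hv : SqIntegrable v π) :
    crossMoment π (fun ω => u ω + u' ω) v = crossMoment π u v + crossMoment π u' v := by
  ext i j
  simp only [crossMoment, Matrix.of_apply, Matrix.add_apply, Pi.add_apply, add_mul]
  exact integral_add (hu.integrable_mul hv i j) (hu'.integrable_mul hv i j)

theorem crossMoment_add_right (hu : SqIntegrable u π) (hv : SqIntegrable v π)
    (hv' : SqIntegrable v' π) :
    crossMoment π u (fun ω => v ω + v' ω) = crossMoment π u v + crossMoment π u v' := by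
  rw [← crossMoment_transpose, crossMoment_add_left hv hv' hu, Matrix.transpose_add,
    crossMoment_transpose, crossMoment_transpose]

theorem crossMoment_congr (hu : u =ᵐ[π] u') (hv : v =ᵐ[π] v') :
    crossMoment π u v = crossMoment π u' v' := by
  ext i j
  refine integral_congr_ae ?_
  filter_upwards [hu, hv] with ω h1 h2
  rw [h1, h2]

theorem crossMoment_map {Ω' : Type*} [MeasurableSpace Ω'] {φ : Ω → Ω'} (hφ : Measurable φ)
    {u v : Ω' → ι → ℝ} (hu : Measurable u) (hv : Measurable v) :
    crossMoment (π.map φ) u v = crossMoment π (u ∘ φ) (v ∘ φ) := by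
  ext i j
  exact integral_map hφ.aemeasurable (by fun_prop)

variable [Fintype ι]

theorem crossMoment_mulVec_left (hu : SqIntegrable u π) (hv : SqIntegrable v π)
    (A : Matrix ι ι ℝ) :
    crossMoment π (fun ω => A *ᵥ u ω) v = A * crossMoment π u v := by
  ext i j
  simp only [crossMoment, Matrix.of_apply, Matrix.mul_apply, Matrix.mulVec, dotProduct,
    Finset.sum_mul]
  rw [integral_finsetSum _ fun k _ => ((hu.integrable_mul hv k j).const_mul (A i k)).congr
    (ae_of_all _ fun ω => (mul_assoc _ _ _).symm)]
  exact Finset.sum_congr rfl fun k _ => by simp_rw [mul_assoc, integral_const_mul]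

theorem crossMoment_mulVec_right (hu : SqIntegrable u π) (hv : SqIntegrable v π)
    (A : Matrix ι ι ℝ) :
    crossMoment π u (fun ω => A *ᵥ v ω) = crossMoment π u v * Aᵀ := by
  rw [← crossMoment_transpose, crossMoment_mulVec_left hv hu, Matrix.transpose_mul,
    crossMoment_transpose]

theorem SqIntegrable.integrable_quadratic (hu : SqIntegrable u π) (M : Matrix ι ι ℝ) :
    Integrable (fun ω => u ω ⬝ᵥ M *ᵥ u ω) π :=
  integrable_finsetSum _ fun i _ => hu.integrable_mul (hu.mulVec M) i i

theorem integral_quadratic (hu : SqIntegrable u π) (M : Matrix ι ι ℝ) :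
    ∫ ω, u ω ⬝ᵥ M *ᵥ u ω ∂π = (M * crossMoment π u u).trace := by
  rw [← crossMoment_mulVec_left hu hu]
  simp only [dotProduct, Matrix.trace, Matrix.diag, crossMoment, Matrix.of_apply]
  rw [integral_finsetSum _ fun i _ => hu.integrable_mul (hu.mulVec M) i i]
  simp_rw [mul_comm]

theorem crossMoment_posSemidef (hu : SqIntegrable u π) : (crossMoment π u u).PosSemidef := by
  refine Matrix.PosSemidef.of_dotProduct_mulVec_nonneg ?_ fun x => ?_
  · rw [Matrix.IsHermitian, Matrix.conjTranspose_eq_transpose_of_trivial, crossMoment_transpose]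
  -- For the rank-one matrix `x xᵀ` the integrand is the square of `x ⬝ᵥ u`.
  · have h := integral_quadratic hu (Matrix.vecMulVec x x)
    have e : (Matrix.vecMulVec x x * crossMoment π u u).trace =
        x ⬝ᵥ crossMoment π u u *ᵥ x := by
      rw [Matrix.vecMulVec_mul, Matrix.trace_vecMulVec, Matrix.dotProduct_mulVec, dotProduct_comm]
    rw [star_trivial, ← e, ← h]
    refine integral_nonneg fun ω => ?_
    rw [Matrix.vecMulVec_mulVec]
    simp only [op_smul_eq_smul, dotProduct_smul, smul_eq_mul, Pi.zero_apply]
    rw [dotProduct_comm]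
    exact mul_self_nonneg _

theorem ae_eq_zero_of_crossMoment_eq_zero (hu : SqIntegrable u π)
    (h : crossMoment π u u = 0) : ∀ᵐ ω ∂π, u ω = 0 := by
  have : ∀ i, ∀ᵐ ω ∂π, u ω i = 0 := by
    intro i
    have h1 : ∫ ω, u ω i * u ω i ∂π = 0 := congrFun (congrFun h i) i
    rw [integral_eq_zero_iff_of_nonneg (fun ω => mul_self_nonneg _) (hu.integrable_mul hu i i)]
      at h1
    filter_upwards [h1] with ω hω
    exact mul_self_eq_zero.1 hω
  filter_upwards [ae_all_iff.2 this] with ω hω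
  ext i
  exact hω i

/-- A random vector lies almost surely in the range of its second moment matrix. -/
theorem ae_mulVec_eq_zero_of_mul_crossMoment (hu : SqIntegrable u π) {A : Matrix ι ι ℝ}
    (h : A * crossMoment π u u = 0) : ∀ᵐ ω ∂π, A *ᵥ u ω = 0 :=
  ae_eq_zero_of_crossMoment_eq_zero (hu.mulVec A) (by
    rw [crossMoment_mulVec_left hu (hu.mulVec A), crossMoment_mulVec_right hu hu,
      ← Matrix.mul_assoc, h, Matrix.zero_mul])

end SecondMoments

/-! ### Moments of the source and distortions as block traces -/

section Source

variable {p₁ p₂ : ℕ} {Q : Mat p₁ p₂} {π : Measure (Vec p₁ p₂ × Vec p₁ p₂)}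

theorem integral_apply_multivariateGaussian (m : Vec p₁ p₂) (Q : Mat p₁ p₂) (i : Idx p₁ p₂) :
    ∫ x : Vec p₁ p₂, x i ∂(multivariateGaussian m Q) = m i := by
  have h := (EuclideanSpace.proj i : Vec p₁ p₂ →L[ℝ] ℝ).integral_comp_comm
    (IsGaussian.integrable_fun_id (μ := multivariateGaussian m Q))
  rw [integral_id_multivariateGaussian] at h
  exact h

theorem memLp_apply_of_isGaussian (μ : Measure (Vec p₁ p₂)) [IsGaussian μ] (i : Idx p₁ p₂) :
    MemLp (fun x : Vec p₁ p₂ => x i) 2 μ :=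
  (EuclideanSpace.proj i : Vec p₁ p₂ →L[ℝ] ℝ).comp_memLp' IsGaussian.memLp_two_id

instance isGaussian_gaussian (Q : Mat p₁ p₂) : IsGaussian (gaussian Q) :=
  isGaussian_multivariateGaussian

theorem crossMoment_gaussian (hQ : Q.PosSemidef) :
    crossMoment (gaussian Q) (fun x => x.ofLp) (fun x => x.ofLp) = Q := by
  ext i j
  have h := covariance_eval_multivariateGaussian (μ := (0 : Vec p₁ p₂)) hQ i j
  rw [covariance_eq_sub (memLp_apply_of_isGaussian _ i) (memLp_apply_of_isGaussian _ j),
    integral_apply_multivariateGaussian, integral_apply_multivariateGaussian] at h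
  simp only [PiLp.zero_apply, mul_zero, sub_zero] at h
  exact h

theorem sqIntegrable_gaussian (Q : Mat p₁ p₂) :
    SqIntegrable (fun x : Vec p₁ p₂ => x.ofLp) (gaussian Q) :=
  fun i => memLp_apply_of_isGaussian _ i

theorem sqIntegrable_fst (h : π.fst = gaussian Q) :
    SqIntegrable (fun z : Vec p₁ p₂ × Vec p₁ p₂ => z.1.ofLp) π := fun i => by
  have := sqIntegrable_gaussian Q i
  rw [← h, Measure.fst] at this
  exact this.comp_of_map measurable_fst.aemeasurable

theorem crossMoment_fst (hQ : Q.PosSemidef) (h : π.fst = gaussian Q) :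
    crossMoment π (fun z => z.1.ofLp) (fun z => z.1.ofLp) = Q := by
  have h1 := crossMoment_gaussian hQ
  rw [← h, Measure.fst, crossMoment_map measurable_fst (by fun_prop) (by fun_prop)] at h1
  exact h1

theorem distortion₁_eq
    (h : SqIntegrable (fun z : Vec p₁ p₂ × Vec p₁ p₂ => z.1.ofLp - z.2.ofLp) π) :
    distortion₁ π = ENNReal.ofReal (crossMoment π (fun z => z.1.ofLp - z.2.ofLp)
      (fun z => z.1.ofLp - z.2.ofLp)).toBlocks₁₁.trace := by
  rw [distortion₁, ← ofReal_integral_eq_lintegral_ofReal]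
  · congr 1
    simp only [Matrix.trace, Matrix.diag, Matrix.toBlocks₁₁, Matrix.of_apply, crossMoment,
      Pi.sub_apply, sq]
    exact integral_finsetSum _ fun i _ => h.integrable_mul h (Sum.inl i) (Sum.inl i)
  · exact integrable_finsetSum _ fun i _ => (h (Sum.inl i)).integrable_sq
  · exact ae_of_all _ fun z => Finset.sum_nonneg fun i _ => sq_nonneg _

theorem distortion₂_eq
    (h : SqIntegrable (fun z : Vec p₁ p₂ × Vec p₁ p₂ => z.1.ofLp - z.2.ofLp) π) :
    distortion₂ π = ENNReal.ofReal (crossMoment π (fun z => z.1.ofLp - z.2.ofLp)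
      (fun z => z.1.ofLp - z.2.ofLp)).toBlocks₂₂.trace := by
  rw [distortion₂, ← ofReal_integral_eq_lintegral_ofReal]
  · congr 1
    simp only [Matrix.trace, Matrix.diag, Matrix.toBlocks₂₂, Matrix.of_apply, crossMoment,
      Pi.sub_apply, sq]
    exact integral_finsetSum _ fun i _ => h.integrable_mul h (Sum.inr i) (Sum.inr i)
  · exact integrable_finsetSum _ fun i _ => (h (Sum.inr i)).integrable_sq
  · exact ae_of_all _ fun z => Finset.sum_nonneg fun i _ => sq_nonneg _

theorem memLp_two_of_lintegral_sum_sq {Ω κ : Type*} [MeasurableSpace Ω] [Fintype κ]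
    {π : Measure Ω} {g : κ → Ω → ℝ} (hg : ∀ k, Measurable (g k))
    (h : ∫⁻ z, ENNReal.ofReal (∑ k, g k z ^ 2) ∂π ≠ ⊤) (k : κ) : MemLp (g k) 2 π := by
  rw [memLp_two_iff_integrable_sq (hg k).aestronglyMeasurable]
  refine ⟨((hg k).pow_const 2).aestronglyMeasurable, ?_⟩
  rw [hasFiniteIntegral_iff_ofReal (ae_of_all _ fun z => sq_nonneg _)]
  refine lt_of_le_of_lt (lintegral_mono fun z => ENNReal.ofReal_le_ofReal ?_) h.lt_top
  exact Finset.single_le_sum (f := fun k => g k z ^ 2) (fun _ _ => sq_nonneg _)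
    (Finset.mem_univ k)

/-- Finite distortion is the only source of integrability: together with the Gaussian marginal it
makes the reproduction square integrable. -/
theorem sqIntegrable_error {Δ₁ Δ₂ : ℝ} {μ : Measure (Vec p₁ p₂)} (h : π ∈ feasible μ Δ₁ Δ₂) :
    SqIntegrable (fun z : Vec p₁ p₂ × Vec p₁ p₂ => z.1.ofLp - z.2.ofLp) π := by
  obtain ⟨-, -, h₁, h₂⟩ := h
  rintro (i | i)
  · exact memLp_two_of_lintegral_sum_sq
      (g := fun (i : Fin p₁) (z : Vec p₁ p₂ × Vec p₁ p₂) => z.1 (Sum.inl i) - z.2 (Sum.inl i))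
      (fun i => by fun_prop) (ne_top_of_le_ne_top ENNReal.ofReal_ne_top h₁) i
  · exact memLp_two_of_lintegral_sum_sq
      (g := fun (i : Fin p₂) (z : Vec p₁ p₂ × Vec p₁ p₂) => z.1 (Sum.inr i) - z.2 (Sum.inr i))
      (fun i => by fun_prop) (ne_top_of_le_ne_top ENNReal.ofReal_ne_top h₂) i

end Source

/-! ### The lower bound -/

section LowerBound

variable {p₁ p₂ : ℕ} {Q S : Mat p₁ p₂} {π : Measure (Vec p₁ p₂ × Vec p₁ p₂)}

theorem measurable_gaussianLLR (Q M : Mat p₁ p₂) {φ : Vec p₁ p₂ → Vec p₁ p₂}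
    (hφ : Measurable φ) :
    Measurable fun z : Vec p₁ p₂ × Vec p₁ p₂ => gaussianLLR Q M z.1 (φ z.2) :=
  Measurable.comp (g := fun z : Vec p₁ p₂ × Vec p₁ p₂ => gaussianLLR Q M z.1 z.2)
    (f := fun z : Vec p₁ p₂ × Vec p₁ p₂ => (z.1, φ z.2))
    (continuous_gaussianLLR Q M).measurable (measurable_fst.prodMk (hφ.comp measurable_snd))

/-- For fixed `y` the integrand is the density of the probability measure `G(φ y, S)` relative to
`G(0, Q)`. This is the normalization that the Donsker-Varadhan bound requires. -/
theorem lintegral_exp_gaussianLLR (hQ : Q.PosSemidef) (hS : S.PosSemidef)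
    (hSP : S * kerProj Q = 0) (hd : (S + kerProj Q).PosDef) (ν : Measure (Vec p₁ p₂))
    [IsProbabilityMeasure ν] {φ : Vec p₁ p₂ → Vec p₁ p₂} (hφm : Measurable φ)
    (hφ : ∀ y, kerProj Q *ᵥ (φ y).ofLp = 0) :
    ∫⁻ z, ENNReal.ofReal (Real.exp (gaussianLLR (Q + kerProj Q) (S + kerProj Q) z.1 (φ z.2)))
      ∂((gaussian Q).prod ν) = 1 := by
  have hm := measurable_gaussianLLR (Q + kerProj Q) (S + kerProj Q) hφm
  rw [lintegral_prod_symm _ hm.exp.ennreal_ofReal.aemeasurable]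
  have h1 : ∀ y, ∫⁻ x, ENNReal.ofReal (Real.exp
      (gaussianLLR (Q + kerProj Q) (S + kerProj Q) x (φ y))) ∂(gaussian Q) = 1 := by
    intro y
    have h2 := multivariateGaussian_eq_gaussian_withDensity hQ hS hSP hd (hφ y)
    rw [← setLIntegral_univ, ← withDensity_apply _ MeasurableSet.univ, ← h2, measure_univ]
  simp [h1]

theorem integrable_gaussianLLR {M N : Mat p₁ p₂} {φ : Vec p₁ p₂ → Vec p₁ p₂}
    (h1 : SqIntegrable (fun z : Vec p₁ p₂ × Vec p₁ p₂ => z.1.ofLp) π) [IsFiniteMeasure π]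
    (h2 : SqIntegrable (fun z : Vec p₁ p₂ × Vec p₁ p₂ => z.1.ofLp - (φ z.2).ofLp) π) :
    Integrable (fun z => gaussianLLR N M z.1 (φ z.2)) π :=
  ((integrable_const _).sub ((h2.integrable_quadratic _).div_const 2)).add
    ((h1.integrable_quadratic _).div_const 2)

theorem integral_gaussianLLR {M N : Mat p₁ p₂} {φ : Vec p₁ p₂ → Vec p₁ p₂}
    (h1 : SqIntegrable (fun z : Vec p₁ p₂ × Vec p₁ p₂ => z.1.ofLp) π) [IsProbabilityMeasure π]
    (h2 : SqIntegrable (fun z : Vec p₁ p₂ × Vec p₁ p₂ => z.1.ofLp - (φ z.2).ofLp) π) :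
    ∫ z, gaussianLLR N M z.1 (φ z.2) ∂π = 1 / 2 * Real.log (N.det / M.det) -
      (M⁻¹ * crossMoment π (fun z => z.1.ofLp - (φ z.2).ofLp)
        (fun z => z.1.ofLp - (φ z.2).ofLp)).trace / 2 +
      (N⁻¹ * crossMoment π (fun z => z.1.ofLp) (fun z => z.1.ofLp)).trace / 2 := by
  rw [← integral_quadratic h1, ← integral_quadratic h2]
  simp only [gaussianLLR, WithLp.ofLp_sub]
  rw [integral_add, integral_sub, integral_div, integral_div, integral_const]
  · simp
  · exact integrable_const _
  · exact (h2.integrable_quadratic _).div_const 2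
  · exact (integrable_const _).sub ((h2.integrable_quadratic _).div_const 2)
  · exact (h1.integrable_quadratic _).div_const 2

/-- Every feasible law has the second moments of a linear estimator with an error covariance
in the constraint set. -/
theorem exists_linear_estimator (hQ : Q.PosSemidef) {Δ₁ Δ₂ : ℝ} (h₁ : 0 ≤ Δ₁) (h₂ : 0 ≤ Δ₂)
    (hπ : π ∈ feasible (gaussian Q) Δ₁ Δ₂) :
    ∃ A S : Mat p₁ p₂, S ∈ constraintSetPD Q Δ₁ Δ₂ ∧ kerProj Q * A = 0 ∧
      SqIntegrable (fun z : Vec p₁ p₂ × Vec p₁ p₂ => z.1.ofLp - A *ᵥ z.2.ofLp) π ∧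
      crossMoment π (fun z => z.1.ofLp - A *ᵥ z.2.ofLp) (fun z => z.1.ofLp - A *ᵥ z.2.ofLp) =
        S := by
  have hE := sqIntegrable_error hπ
  obtain ⟨hprob, hfst, hd₁, hd₂⟩ := hπ
  have hX := sqIntegrable_fst hfst
  have hY : SqIntegrable (fun z : Vec p₁ p₂ × Vec p₁ p₂ => z.2.ofLp) π := by
    simpa using hX.sub hE
  rw [distortion₁_eq hE, ENNReal.ofReal_le_ofReal_iff h₁] at hd₁
  rw [distortion₂_eq hE, ENNReal.ofReal_le_ofReal_iff h₂] at hd₂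
  set X : Vec p₁ p₂ × Vec p₁ p₂ → Idx p₁ p₂ → ℝ := fun z => z.1.ofLp
  set Y : Vec p₁ p₂ × Vec p₁ p₂ → Idx p₁ p₂ → ℝ := fun z => z.2.ofLp
  have hXX : crossMoment π X X = Q := crossMoment_fst hQ hfst
  set C := crossMoment π Y Y with hC
  set B := crossMoment π X Y with hB
  have hCp : C.PosSemidef := crossMoment_posSemidef hY
  have hCd := posDef_add_kerProj hCp
  have hzero : ∀ u : Vec p₁ p₂ × Vec p₁ p₂ → Idx p₁ p₂ → ℝ, crossMoment π 0 u = 0 := by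
    intro u; ext i j; simp [crossMoment]
  -- `X` lies almost surely in the range of `Q`, and `Y` in the range of `C`; hence the two
  -- annihilation relations for `B`.
  have hPB : kerProj Q * B = 0 := by
    have h := ae_mulVec_eq_zero_of_mul_crossMoment hX (A := kerProj Q) (by
      rw [hXX]; exact kerProj_mul_of_mul_kerProj hQ.transpose_eq (mul_kerProj Q))
    rw [hB, ← crossMoment_mulVec_left hX hY, ← hzero Y]
    exact crossMoment_congr h (ae_eq_refl _)
  have hBP : B * kerProj C = 0 := by
    have h := ae_mulVec_eq_zero_of_mul_crossMoment hY (A := kerProj C)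
      (kerProj_mul_of_mul_kerProj hCp.transpose_eq (mul_kerProj C))
    rw [hB, ← kerProj_transpose, ← crossMoment_mulVec_right hX hY, ← crossMoment_transpose,
      ← Matrix.transpose_zero, ← hzero X]
    exact congrArg _ (crossMoment_congr h (ae_eq_refl _))
  -- A solution of the normal equation `A * C = B` that exists even for singular `C`.
  set A := B * (C + kerProj C)⁻¹ with hA
  have hAC : A * C = B := by
    rw [hA, Matrix.mul_assoc, inv_mul_add_kerProj (mul_kerProj C) hCd, Matrix.mul_sub, hBP]
    simp
  have hCA : C * Aᵀ = Bᵀ := by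
    have := congrArg Matrix.transpose hAC
    rwa [Matrix.transpose_mul, hCp.transpose_eq] at this
  have hAY := hY.mulVec A
  have hZ := hX.sub hAY
  have hS : crossMoment π (fun z => X z - A *ᵥ Y z) (fun z => X z - A *ᵥ Y z) =
      Q - A * C * Aᵀ := by
    rw [crossMoment_sub_left hX hAY hZ, crossMoment_sub_right hX hX hAY,
      crossMoment_sub_right hAY hX hAY, crossMoment_mulVec_right hX hY,
      crossMoment_mulVec_right hAY hY, crossMoment_mulVec_left hY hY,
      crossMoment_mulVec_left hY hX, hXX, ← crossMoment_transpose π X Y, ← hB, ← hC, ← hCA, ← hAC,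
      Matrix.mul_assoc]
    abel
  -- Pythagoras: `X - Y` is the sum of `X - A Y` and `(A - 1) Y`, which are uncorrelated. The
  -- positive semidefinite second term shows that the linear estimate meets both trace constraints.
  have hEE : crossMoment π (fun z => X z - Y z) (fun z => X z - Y z) =
      (Q - A * C * Aᵀ) + (A - 1) * C * (A - 1)ᴴ := by
    rw [crossMoment_sub_left hX hY hE, crossMoment_sub_right hX hX hY,
      crossMoment_sub_right hY hX hY, hXX, ← crossMoment_transpose π X Y, ← hB, ← hC, ← hCA,
      Matrix.conjTranspose_eq_transpose_of_trivial, Matrix.transpose_sub, Matrix.transpose_one,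
      Matrix.mul_sub, Matrix.sub_mul, Matrix.sub_mul, hAC]
    simp only [Matrix.one_mul, Matrix.mul_one]
    abel
  have hN := hCp.mul_mul_conjTranspose_same (A - 1)
  refine ⟨A, Q - A * C * Aᵀ, ⟨?_, hS ▸ crossMoment_posSemidef hZ, ?_, ?_⟩, ?_, hZ, hS⟩
  · rw [sub_sub_cancel, ← Matrix.conjTranspose_eq_transpose_of_trivial]
    exact hCp.mul_mul_conjTranspose_same A
  · have h3 := (hN.submatrix Sum.inl).trace_nonneg
    have h4 := congrArg (fun M : Mat p₁ p₂ => M.toBlocks₁₁.trace) hEE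
    have h5 : ∀ M N : Mat p₁ p₂, (M + N).toBlocks₁₁.trace =
      M.toBlocks₁₁.trace + (N.submatrix Sum.inl Sum.inl).trace := fun M N =>
        Matrix.trace_add M.toBlocks₁₁ N.toBlocks₁₁
    simp only [h5] at h4
    linarith
  · have h3 := (hN.submatrix Sum.inr).trace_nonneg
    have h4 := congrArg (fun M : Mat p₁ p₂ => M.toBlocks₂₂.trace) hEE
    have h5 : ∀ M N : Mat p₁ p₂, (M + N).toBlocks₂₂.trace =
      M.toBlocks₂₂.trace + (N.submatrix Sum.inr Sum.inr).trace := fun M N =>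
        Matrix.trace_add M.toBlocks₂₂ N.toBlocks₂₂
    simp only [h5] at h4
    linarith
  · rw [hA, ← Matrix.mul_assoc, hPB, Matrix.zero_mul]

/-- The trace is the mean of the quadratic form of `S` under `G(0, Q)`. -/
theorem trace_mul_nonneg (hQ : Q.PosSemidef) (hS : S.PosSemidef) : 0 ≤ (S * Q).trace := by
  rw [← crossMoment_gaussian hQ, ← integral_quadratic (sqIntegrable_gaussian Q)]
  refine integral_nonneg fun x => ?_
  have := hS.dotProduct_mulVec_nonneg x.ofLp
  rwa [star_trivial] at this

/-- The lower bound on the mutual information given by a nondegenerate Gaussian backward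
channel. -/
theorem le_mutualInfo_of_covariance (hQ : Q.PosSemidef) [IsProbabilityMeasure π]
    (hfst : π.fst = gaussian Q) {A : Mat p₁ p₂} (hA : kerProj Q * A = 0)
    (hZ : SqIntegrable (fun z : Vec p₁ p₂ × Vec p₁ p₂ => z.1.ofLp - A *ᵥ z.2.ofLp) π)
    {T : Mat p₁ p₂} (hT : T.PosSemidef) (hTP : T * kerProj Q = 0)
    (hd : (T + kerProj Q).PosDef)
    (hST : (T - crossMoment π (fun z => z.1.ofLp - A *ᵥ z.2.ofLp)
      (fun z => z.1.ofLp - A *ᵥ z.2.ofLp)).PosSemidef) :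
    ((1 / 2 * Real.log ((Q + kerProj Q).det / (T + kerProj Q).det) : ℝ) : EReal) ≤
      (mutualInfo π : EReal) := by
  set φ : Vec p₁ p₂ → Vec p₁ p₂ := fun y => Matrix.toEuclideanCLM (𝕜 := ℝ) A y with hφ
  have hφm : Measurable φ := by fun_prop
  have hφ0 : ∀ y, kerProj Q *ᵥ (φ y).ofLp = 0 := by
    intro y
    rw [hφ, Matrix.ofLp_toEuclideanCLM, Matrix.mulVec_mulVec, hA, Matrix.zero_mulVec]
  have hX := sqIntegrable_fst hfst
  have hZ' : SqIntegrable (fun z : Vec p₁ p₂ × Vec p₁ p₂ => z.1.ofLp - (φ z.2).ofLp) π := hZ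
  have hsnd : IsProbabilityMeasure π.snd := inferInstance
  have key := integral_le_klDiv (μ := π) (ν := π.fst.prod π.snd)
    (measurable_gaussianLLR (Q + kerProj Q) (T + kerProj Q) hφm)
    (integrable_gaussianLLR hX hZ')
    (by rw [hfst]; exact lintegral_exp_gaussianLLR hQ hT hTP hd π.snd hφm hφ0)
  refine le_trans ?_ key
  rw [integral_gaussianLLR hX hZ', crossMoment_fst hQ hfst,
    inv_mul_add_kerProj (mul_kerProj Q) (posDef_add_kerProj hQ)]
  -- Since `T` dominates the error covariance, the negative trace term is at most the trace of `1 -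
  -- kerProj Q` in size, which is exactly the positive term coming from `Q`.
  have h1 := trace_mul_nonneg hST hd.inv.posSemidef
  rw [Matrix.mul_sub, inv_mul_add_kerProj hTP hd, Matrix.trace_sub] at h1
  have h2 : (fun z : Vec p₁ p₂ × Vec p₁ p₂ => z.1.ofLp - (φ z.2).ofLp) =
    fun z => z.1.ofLp - A *ᵥ z.2.ofLp := rfl
  rw [h2, EReal.coe_le_coe_iff]
  linarith

/-- The error covariance `S` may be degenerate on the range of `Q`, so the bound is used for `S + ε
Q`. Written as a lower bound on a determinant it survives `ε → 0`, and the limit shows that finite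
information forces `S` to be nondegenerate there. -/
theorem rate_le_mutualInfo (hQ : Q.PosSemidef) {Δ₁ Δ₂ : ℝ} (h₁ : 0 ≤ Δ₁) (h₂ : 0 ≤ Δ₂)
    (hπ : π ∈ feasible (gaussian Q) Δ₁ Δ₂) :
    ∃ S ∈ constraintSetPD Q Δ₁ Δ₂, rate Q S ≤ (mutualInfo π : EReal) := by
  obtain ⟨A, S, hS, hA, hZ, hSZ⟩ := exists_linear_estimator hQ h₁ h₂ hπ
  obtain ⟨hprob, hfst, -, -⟩ := hπ
  refine ⟨S, hS, ?_⟩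
  by_cases htop : mutualInfo π = ⊤
  · simp [htop]
  have hQd := posDef_add_kerProj hQ
  have hSP := mul_kerProj_of_le hS.2.1 hS.1
  set r := (mutualInfo π).toReal with hr
  have hcoe : (mutualInfo π : EReal) = (r : EReal) := (EReal.coe_ennreal_toReal htop).symm
  have hbound : ∀ ε : ℝ, 0 < ε → ε ≤ 1 →
      (Q + kerProj Q).det * Real.exp (-(2 * r)) ≤ (S + ε • Q + kerProj Q).det := by
    intro ε h0 hle
    have hd : (S + ε • Q + kerProj Q).PosDef := by
      -- A positive definite plus a positive semidefinite matrix; `ε ≤ 1` is needed for the last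
      -- coefficient.
      have e : S + ε • Q + kerProj Q = ε • (Q + kerProj Q) + (S + (1 - ε) • kerProj Q) := by
        rw [smul_add, sub_smul, one_smul]; abel
      rw [e]
      exact (hQd.smul h0).add_posSemidef
        (hS.2.1.add ((kerProj_posSemidef Q).smul (by linarith)))
    have hεQ : (ε • Q).PosSemidef := hQ.smul h0.le
    have h3 := le_mutualInfo_of_covariance hQ hfst hA hZ (hS.2.1.add hεQ)
      (by rw [Matrix.add_mul, hSP, Matrix.smul_mul, mul_kerProj, smul_zero, add_zero]) hd
      (by rw [hSZ, add_sub_cancel_left]; exact hεQ)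
    rw [hcoe, EReal.coe_le_coe_iff] at h3
    have h4 : (Q + kerProj Q).det / (S + ε • Q + kerProj Q).det ≤ Real.exp (2 * r) := by
      rw [← Real.log_le_iff_le_exp (div_pos hQd.det_pos hd.det_pos)]
      linarith
    rw [div_le_iff₀ hd.det_pos] at h4
    rw [Real.exp_neg, ← div_eq_mul_inv, div_le_iff₀ (Real.exp_pos _), mul_comm]
    exact h4
  have hlim : Filter.Tendsto (fun ε : ℝ => (S + ε • Q + kerProj Q).det)
      (nhdsWithin 0 (Set.Ioi 0)) (nhds (S + kerProj Q).det) := by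
    have hc : Continuous fun ε : ℝ => (S + ε • Q + kerProj Q).det := by fun_prop
    have := hc.tendsto 0
    rw [zero_smul, add_zero] at this
    exact this.mono_left nhdsWithin_le_nhds
  have hge : (Q + kerProj Q).det * Real.exp (-(2 * r)) ≤ (S + kerProj Q).det := by
    refine ge_of_tendsto hlim ?_
    filter_upwards [Ioc_mem_nhdsGT (zero_lt_one (α := ℝ))] with ε hε
    exact hbound ε hε.1 hε.2
  have hpos : 0 < (S + kerProj Q).det :=
    lt_of_lt_of_le (mul_pos hQd.det_pos (Real.exp_pos _)) hge
  rw [rate, halfLogRatio, if_pos hpos, hcoe, EReal.coe_le_coe_iff]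
  have h5 : Real.log ((Q + kerProj Q).det / (S + kerProj Q).det) ≤ 2 * r := by
    rw [Real.log_le_iff_le_exp (div_pos hQd.det_pos hpos), div_le_iff₀ hpos]
    rwa [Real.exp_neg, ← div_eq_mul_inv, div_le_iff₀ (Real.exp_pos _), mul_comm] at hge
  linarith

end LowerBound

/-! ### Gaussian realizations -/

section Centered

variable {p₁ p₂ : ℕ} {Ω : Type*} [MeasurableSpace Ω] {π : Measure Ω} {U V : Ω → Vec p₁ p₂}

theorem inner_eq_sum (x y : Vec p₁ p₂) : inner ℝ x y = ∑ i, x i * y i := by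
  simp [PiLp.inner_apply, mul_comm]

theorem covariance_inner [IsProbabilityMeasure π]
    (hU : SqIntegrable (fun ω => (U ω).ofLp) π) (hV : SqIntegrable (fun ω => (V ω).ofLp) π)
    (hU0 : ∀ i, ∫ ω, U ω i ∂π = 0) (x y : Vec p₁ p₂) :
    cov[fun ω => inner ℝ x (U ω), fun ω => inner ℝ y (V ω); π] =
      x.ofLp ⬝ᵥ crossMoment π (fun ω => (U ω).ofLp) (fun ω => (V ω).ofLp) *ᵥ y.ofLp := by
  simp only [inner_eq_sum]
  rw [covariance_fun_sum_fun_sum (fun i => (hU i).const_mul _) (fun i => (hV i).const_mul _)]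
  simp only [dotProduct, Matrix.mulVec, Finset.mul_sum, crossMoment, Matrix.of_apply]
  refine Finset.sum_congr rfl fun i _ => Finset.sum_congr rfl fun j _ => ?_
  rw [covariance_const_mul_left, covariance_const_mul_right, covariance_eq_sub (hU i) (hV j),
    hU0 i, zero_mul, sub_zero]
  simp only [Pi.mul_apply]
  ring

/-- A centered Gaussian law is determined by its second moments. -/
theorem map_eq_gaussian {S : Mat p₁ p₂} (hS : S.PosSemidef) (hU : HasGaussianLaw U π)
    (hUi : SqIntegrable (fun ω => (U ω).ofLp) π) (hU0 : ∀ i, ∫ ω, U ω i ∂π = 0)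
    (h : crossMoment π (fun ω => (U ω).ofLp) (fun ω => (U ω).ofLp) = S) :
    π.map U = gaussian S := by
  have := hU.isGaussian_map
  have hprob := hU.isProbabilityMeasure
  have hUm := hU.aemeasurable
  apply IsGaussian.ext
  · rw [gaussian, integral_id_multivariateGaussian', integral_map hUm (by fun_prop)]
    ext i
    have h1 := (EuclideanSpace.proj i : Vec p₁ p₂ →L[ℝ] ℝ).integral_comp_comm hU.integrable
    exact h1.symm.trans (hU0 i)
  · ext x y
    rw [gaussian, covarianceBilin_multivariateGaussian hS,
      covarianceBilin_apply_eq_cov IsGaussian.memLp_two_id,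
      covariance_map (by fun_prop) (by fun_prop) hUm]
    rw [← h]
    exact covariance_inner hUi hUi hU0 x y

/-- Jointly Gaussian uncorrelated centered vectors are independent. -/
theorem indepFun_of_crossMoment_eq_zero (hUV : HasGaussianLaw (fun ω => (U ω, V ω)) π)
    (hU : SqIntegrable (fun ω => (U ω).ofLp) π) (hV : SqIntegrable (fun ω => (V ω).ofLp) π)
    (hU0 : ∀ i, ∫ ω, U ω i ∂π = 0)
    (h : crossMoment π (fun ω => (U ω).ofLp) (fun ω => (V ω).ofLp) = 0) :
    IndepFun U V π := by
  have := hUV.isProbabilityMeasure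
  refine hUV.indepFun_of_covariance_inner fun x y => ?_
  rw [covariance_inner hU hV hU0, h, Matrix.zero_mulVec, dotProduct_zero]

end Centered

section Realization

variable {p₁ p₂ : ℕ} {Q H QV S : Mat p₁ p₂}

/-- The linear map `(x, v) ↦ (x, H x + v)`. -/
def realizationMap (H : Mat p₁ p₂) : Vec p₁ p₂ × Vec p₁ p₂ →L[ℝ] Vec p₁ p₂ × Vec p₁ p₂ :=
  (ContinuousLinearMap.fst ℝ _ _).prod
    ((Matrix.toEuclideanCLM (𝕜 := ℝ) H).comp (ContinuousLinearMap.fst ℝ _ _) +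
      ContinuousLinearMap.snd ℝ _ _)

theorem realizationLaw_eq_map (Q H QV : Mat p₁ p₂) :
    realizationLaw Q H QV = ((gaussian Q).prod (gaussian QV)).map (realizationMap H) := rfl

instance isGaussian_realizationLaw (Q H QV : Mat p₁ p₂) : IsGaussian (realizationLaw Q H QV) := by
  rw [realizationLaw_eq_map]
  infer_instance

theorem realizationLaw_fst (Q H QV : Mat p₁ p₂) : (realizationLaw Q H QV).fst = gaussian Q := by
  rw [realizationLaw_eq_map, Measure.fst, Measure.map_map measurable_fst (by fun_prop)]
  exact Measure.fst_prod

theorem sqIntegrable_fst_of_isGaussian (μ : Measure (Vec p₁ p₂ × Vec p₁ p₂)) [IsGaussian μ] :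
    SqIntegrable (fun z : Vec p₁ p₂ × Vec p₁ p₂ => z.1.ofLp) μ := fun i =>
  ((EuclideanSpace.proj i : Vec p₁ p₂ →L[ℝ] ℝ).comp
    (ContinuousLinearMap.fst ℝ (Vec p₁ p₂) (Vec p₁ p₂))).comp_memLp'
      (IsGaussian.memLp_two_id (μ := μ))

theorem sqIntegrable_snd_of_isGaussian (μ : Measure (Vec p₁ p₂ × Vec p₁ p₂)) [IsGaussian μ] :
    SqIntegrable (fun z : Vec p₁ p₂ × Vec p₁ p₂ => z.2.ofLp) μ := fun i =>
  ((EuclideanSpace.proj i : Vec p₁ p₂ →L[ℝ] ℝ).comp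
    (ContinuousLinearMap.snd ℝ (Vec p₁ p₂) (Vec p₁ p₂))).comp_memLp'
      (IsGaussian.memLp_two_id (μ := μ))

theorem integral_gaussian_apply (Q : Mat p₁ p₂) (i : Idx p₁ p₂) :
    ∫ x : Vec p₁ p₂, x i ∂(gaussian Q) = 0 :=
  integral_apply_multivariateGaussian 0 Q i

theorem crossMoment_prod (Q QV : Mat p₁ p₂) :
    crossMoment ((gaussian Q).prod (gaussian QV)) (fun z => z.1.ofLp) (fun z => z.2.ofLp) = 0 := by
  ext i j
  simp only [crossMoment, Matrix.of_apply]
  rw [integral_prod_mul (fun x : Vec p₁ p₂ => x i) (fun x : Vec p₁ p₂ => x j),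
    integral_gaussian_apply, zero_mul, Matrix.zero_apply]

theorem crossMoment_prod_fst (hQ : Q.PosSemidef) (QV : Mat p₁ p₂) :
    crossMoment ((gaussian Q).prod (gaussian QV)) (fun z => z.1.ofLp) (fun z => z.1.ofLp) = Q :=
  crossMoment_fst hQ Measure.fst_prod

theorem crossMoment_prod_snd (Q : Mat p₁ p₂) (hQV : QV.PosSemidef) :
    crossMoment ((gaussian Q).prod (gaussian QV)) (fun z => z.2.ofLp) (fun z => z.2.ofLp) =
      QV := by
  have h1 := crossMoment_gaussian hQV
  rw [← Measure.snd_prod (μ := gaussian Q) (ν := gaussian QV), Measure.snd,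
    crossMoment_map measurable_snd (by fun_prop) (by fun_prop)] at h1
  exact h1

theorem crossMoment_realizationLaw_snd_fst (hQ : Q.PosSemidef) (H QV : Mat p₁ p₂) :
    crossMoment (realizationLaw Q H QV) (fun z => z.2.ofLp) (fun z => z.1.ofLp) = H * Q := by
  have hX := sqIntegrable_fst_of_isGaussian ((gaussian Q).prod (gaussian QV))
  have hV := sqIntegrable_snd_of_isGaussian ((gaussian Q).prod (gaussian QV))
  rw [realizationLaw_eq_map, crossMoment_map (by fun_prop) (by fun_prop) (by fun_prop)]
  change crossMoment _ (fun z : Vec p₁ p₂ × Vec p₁ p₂ => H *ᵥ z.1.ofLp + z.2.ofLp)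
    (fun z => z.1.ofLp) = _
  rw [crossMoment_add_left (hX.mulVec H) hV hX, crossMoment_mulVec_left hX hX,
    crossMoment_prod_fst hQ, ← crossMoment_transpose, crossMoment_prod, Matrix.transpose_zero,
    add_zero]

theorem crossMoment_realizationLaw_fst_snd (hQ : Q.PosSemidef) (H QV : Mat p₁ p₂) :
    crossMoment (realizationLaw Q H QV) (fun z => z.1.ofLp) (fun z => z.2.ofLp) = Q * Hᵀ := by
  rw [← crossMoment_transpose, crossMoment_realizationLaw_snd_fst hQ, Matrix.transpose_mul,
    hQ.transpose_eq]

theorem crossMoment_realizationLaw_snd (hQ : Q.PosSemidef) (H : Mat p₁ p₂)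
    (hQV : QV.PosSemidef) :
    crossMoment (realizationLaw Q H QV) (fun z => z.2.ofLp) (fun z => z.2.ofLp) =
      H * Q * Hᵀ + QV := by
  have hX := sqIntegrable_fst_of_isGaussian ((gaussian Q).prod (gaussian QV))
  have hV := sqIntegrable_snd_of_isGaussian ((gaussian Q).prod (gaussian QV))
  have hY : SqIntegrable (fun z : Vec p₁ p₂ × Vec p₁ p₂ => H *ᵥ z.1.ofLp + z.2.ofLp)
      ((gaussian Q).prod (gaussian QV)) := fun i => ((hX.mulVec H) i).add (hV i)
  rw [realizationLaw_eq_map, crossMoment_map (by fun_prop) (by fun_prop) (by fun_prop)]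
  change crossMoment _ (fun z : Vec p₁ p₂ × Vec p₁ p₂ => H *ᵥ z.1.ofLp + z.2.ofLp)
    (fun z => H *ᵥ z.1.ofLp + z.2.ofLp) = _
  have h := crossMoment_prod Q QV
  have h' := congrArg Matrix.transpose h
  rw [crossMoment_transpose, Matrix.transpose_zero] at h'
  rw [crossMoment_add_left (hX.mulVec H) hV hY, crossMoment_mulVec_left hX hY,
    crossMoment_add_right hX (hX.mulVec H) hV, crossMoment_add_right hV (hX.mulVec H) hV,
    crossMoment_mulVec_right hX hX, crossMoment_mulVec_right hV hX, crossMoment_prod_fst hQ,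
    crossMoment_prod_snd Q hQV, h, h', Matrix.zero_mul, add_zero, zero_add, Matrix.mul_assoc]

theorem integral_realizationLaw_fst (Q H QV : Mat p₁ p₂) (i : Idx p₁ p₂) :
    ∫ z, z.1 i ∂(realizationLaw Q H QV) = 0 := by
  have h := integral_gaussian_apply Q i
  rw [← realizationLaw_fst Q H QV, Measure.fst,
    integral_map measurable_fst.aemeasurable (by fun_prop)] at h
  exact h

theorem integral_realizationLaw_snd (Q H QV : Mat p₁ p₂) (i : Idx p₁ p₂) :
    ∫ z, z.2 i ∂(realizationLaw Q H QV) = 0 := by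
  have hX := sqIntegrable_fst_of_isGaussian ((gaussian Q).prod (gaussian QV))
  have hV := sqIntegrable_snd_of_isGaussian ((gaussian Q).prod (gaussian QV))
  have h1 : ∀ j, ∫ z : Vec p₁ p₂ × Vec p₁ p₂, z.1 j ∂((gaussian Q).prod (gaussian QV)) = 0 :=
    fun j => by
      rw [integral_fun_fst (fun x : Vec p₁ p₂ => x j), integral_gaussian_apply, smul_zero]
  have h2 : ∫ z : Vec p₁ p₂ × Vec p₁ p₂, z.2 i ∂((gaussian Q).prod (gaussian QV)) = 0 := by
    rw [integral_fun_snd (fun x : Vec p₁ p₂ => x i), integral_gaussian_apply, smul_zero]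
  rw [realizationLaw_eq_map, integral_map (by fun_prop) (by fun_prop)]
  change ∫ z : Vec p₁ p₂ × Vec p₁ p₂, ((H *ᵥ z.1.ofLp) i + z.2 i)
    ∂((gaussian Q).prod (gaussian QV)) = 0
  rw [integral_add ((hX.mulVec H i).integrable one_le_two) ((hV i).integrable one_le_two), h2]
  simp only [Matrix.mulVec, dotProduct]
  rw [integral_finsetSum _ fun j _ => ((hX j).integrable one_le_two).const_mul _]
  simp [integral_const_mul, h1]

theorem Realizes.transpose_eq (h : Realizes Q H QV S) : Q * Hᵀ = H * Q :=
  (h.left_eq.trans h.right_eq).symm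

theorem Realizes.second_moment_eq (h : Realizes Q H QV S) : H * Q * Hᵀ + QV = H * Q := by
  rw [h.noise_eq]; abel

/-- Orthogonality principle: under (1), `E[X X̂ᵀ] = Q Hᵀ` and `E[X̂ X̂ᵀ] = H Q Hᵀ + QV` both equal
`H Q`. -/
theorem Realizes.crossMoment_error_snd (hQ : Q.PosSemidef) (h : Realizes Q H QV S) :
    crossMoment (realizationLaw Q H QV) (fun z => z.1.ofLp - z.2.ofLp) (fun z => z.2.ofLp) =
      0 := by
  have hX := sqIntegrable_fst_of_isGaussian (realizationLaw Q H QV)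
  have hY := sqIntegrable_snd_of_isGaussian (realizationLaw Q H QV)
  rw [crossMoment_sub_left hX hY hY, crossMoment_realizationLaw_fst_snd hQ,
    crossMoment_realizationLaw_snd hQ H h.noise_posSemidef, h.second_moment_eq, h.transpose_eq,
    sub_self]

theorem Realizes.crossMoment_error (hQ : Q.PosSemidef) (h : Realizes Q H QV S) :
    crossMoment (realizationLaw Q H QV) (fun z => z.1.ofLp - z.2.ofLp)
      (fun z => z.1.ofLp - z.2.ofLp) = S := by
  have hX := sqIntegrable_fst_of_isGaussian (realizationLaw Q H QV)
  have hY := sqIntegrable_snd_of_isGaussian (realizationLaw Q H QV)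
  rw [crossMoment_sub_right (hX.sub hY) hX hY, h.crossMoment_error_snd hQ, sub_zero,
    crossMoment_sub_left hX hY hX, crossMoment_fst hQ (realizationLaw_fst Q H QV),
    crossMoment_realizationLaw_snd_fst hQ, h.left_eq, sub_sub_cancel]

theorem hasGaussianLaw_error_snd (Q H QV : Mat p₁ p₂) :
    HasGaussianLaw (fun z : Vec p₁ p₂ × Vec p₁ p₂ => (z.1 - z.2, z.2))
      (realizationLaw Q H QV) :=
  IsGaussian.hasGaussianLaw_id.map (((ContinuousLinearMap.fst ℝ (Vec p₁ p₂) (Vec p₁ p₂)) -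
    (ContinuousLinearMap.snd ℝ (Vec p₁ p₂) (Vec p₁ p₂))).prod (ContinuousLinearMap.snd ℝ _ _))

theorem integral_realizationLaw_error (Q H QV : Mat p₁ p₂) (i : Idx p₁ p₂) :
    ∫ z, (z.1 - z.2) i ∂(realizationLaw Q H QV) = 0 := by
  have h := integral_sub ((sqIntegrable_fst_of_isGaussian (realizationLaw Q H QV) i).integrable one_le_two)
    ((sqIntegrable_snd_of_isGaussian (realizationLaw Q H QV) i).integrable one_le_two)
  rw [integral_realizationLaw_fst, integral_realizationLaw_snd, sub_zero] at h
  exact h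

theorem Realizes.indepFun_error (hQ : Q.PosSemidef) (h : Realizes Q H QV S) :
    IndepFun (fun z : Vec p₁ p₂ × Vec p₁ p₂ => z.1 - z.2) Prod.snd (realizationLaw Q H QV) :=
  indepFun_of_crossMoment_eq_zero (hasGaussianLaw_error_snd Q H QV)
    ((sqIntegrable_fst_of_isGaussian (realizationLaw Q H QV)).sub (sqIntegrable_snd_of_isGaussian (realizationLaw Q H QV)))
    (sqIntegrable_snd_of_isGaussian (realizationLaw Q H QV)) (integral_realizationLaw_error Q H QV)
    (h.crossMoment_error_snd hQ)

theorem Realizes.map_error (hQ : Q.PosSemidef) (h : Realizes Q H QV S) :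
    (realizationLaw Q H QV).map (fun z => z.1 - z.2) = gaussian S :=
  map_eq_gaussian (h.cov_posSemidef hQ) (hasGaussianLaw_error_snd Q H QV).fst
    ((sqIntegrable_fst_of_isGaussian (realizationLaw Q H QV)).sub (sqIntegrable_snd_of_isGaussian (realizationLaw Q H QV)))
    (integral_realizationLaw_error Q H QV) (h.crossMoment_error hQ)

/-! ### The conditional mean -/

/-- The `σ`-algebra generated by the reproduction. -/
@[reducible] def sndSigma (p₁ p₂ : ℕ) : MeasurableSpace (Vec p₁ p₂ × Vec p₁ p₂) :=
  MeasurableSpace.comap Prod.snd inferInstance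

theorem integrable_realizationLaw_fst (Q H QV : Mat p₁ p₂) :
    Integrable (Prod.fst : Vec p₁ p₂ × Vec p₁ p₂ → Vec p₁ p₂) (realizationLaw Q H QV) :=
  (ContinuousLinearMap.fst ℝ _ _).integrable_comp
    (IsGaussian.integrable_id (μ := realizationLaw Q H QV))

theorem integrable_realizationLaw_snd (Q H QV : Mat p₁ p₂) :
    Integrable (Prod.snd : Vec p₁ p₂ × Vec p₁ p₂ → Vec p₁ p₂) (realizationLaw Q H QV) :=
  (ContinuousLinearMap.snd ℝ _ _).integrable_comp
    (IsGaussian.integrable_id (μ := realizationLaw Q H QV))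

/-- `X` is `X̂` plus an error that is independent of `X̂` and has mean zero. -/
theorem Realizes.condMean_eq (hQ : Q.PosSemidef) (h : Realizes Q H QV S) :
    condMean (realizationLaw Q H QV) =ᵐ[realizationLaw Q H QV] Prod.snd := by
  set π := realizationLaw Q H QV with hπ
  have hle : sndSigma p₁ p₂ ≤ Prod.instMeasurableSpace := measurable_snd.comap_le
  have hX := integrable_realizationLaw_fst Q H QV
  have hY := integrable_realizationLaw_snd Q H QV
  have hEm : Measurable fun z : Vec p₁ p₂ × Vec p₁ p₂ => z.1 - z.2 := by fun_prop
  have h1 : π[fun z => z.1 - z.2 | sndSigma p₁ p₂] =ᵐ[π] fun _ => ∫ z, (z.1 - z.2) ∂π :=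
    condExp_indep_eq hEm.comap_le hle
      (comap_measurable (fun z : Vec p₁ p₂ × Vec p₁ p₂ => z.1 - z.2)).stronglyMeasurable
      (h.indepFun_error hQ)
  have h0 : ∫ z, (z.1 - z.2) ∂π = 0 := by
    ext i
    have h2 := (EuclideanSpace.proj i : Vec p₁ p₂ →L[ℝ] ℝ).integral_comp_comm (hX.sub hY)
    exact h2.symm.trans (integral_realizationLaw_error Q H QV i)
  have h2 : π[Prod.snd | sndSigma p₁ p₂] = Prod.snd := condExp_of_stronglyMeasurable hle
    (comap_measurable (Prod.snd : Vec p₁ p₂ × Vec p₁ p₂ → Vec p₁ p₂)).stronglyMeasurable hY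
  have h3 : π[(fun z => z.1) - (fun z => z.2) | sndSigma p₁ p₂] =ᵐ[π] π[Prod.fst | sndSigma p₁ p₂] - π[Prod.snd | sndSigma p₁ p₂] :=
    condExp_sub hX hY _
  filter_upwards [h1, h3] with z hz1 hz3
  have h4 : π[(fun z => z.1) - (fun z => z.2) | sndSigma p₁ p₂] z = π[fun z => z.1 - z.2 | sndSigma p₁ p₂] z := rfl
  rw [h4, hz1, h0, Pi.sub_apply, h2] at hz3
  exact (sub_eq_zero.1 hz3.symm)

theorem errorCov_eq_of_condMean (π : Measure (Vec p₁ p₂ × Vec p₁ p₂))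
    (h : condMean π =ᵐ[π] Prod.snd) :
    errorCov π = crossMoment π (fun z => z.1.ofLp - z.2.ofLp) (fun z => z.1.ofLp - z.2.ofLp) := by
  ext i j
  refine integral_congr_ae ?_
  filter_upwards [h] with z hz
  rw [hz]
  rfl

/-- Tower property: `X̂ⱼ` is pulled out of the conditional expectation of `Xᵢ X̂ⱼ` given `X̂`. -/
theorem crossMoment_fst_snd_of_condMean (Q H QV : Mat p₁ p₂)
    (h : condMean (realizationLaw Q H QV) =ᵐ[realizationLaw Q H QV] Prod.snd) :
    crossMoment (realizationLaw Q H QV) (fun z => z.1.ofLp) (fun z => z.2.ofLp) =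
      crossMoment (realizationLaw Q H QV) (fun z => z.2.ofLp) (fun z => z.2.ofLp) := by
  have hX := sqIntegrable_fst_of_isGaussian (realizationLaw Q H QV)
  have hY := sqIntegrable_snd_of_isGaussian (realizationLaw Q H QV)
  have hXi := integrable_realizationLaw_fst Q H QV
  set π := realizationLaw Q H QV with hπ
  have hle : sndSigma p₁ p₂ ≤ Prod.instMeasurableSpace := measurable_snd.comap_le
  ext i j
  have h1 : (fun z => (condMean π z) i) =ᵐ[π] π[fun z => z.1 i | sndSigma p₁ p₂] :=
    (EuclideanSpace.proj i : Vec p₁ p₂ →L[ℝ] ℝ).comp_condExp_comm hXi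
  have hYm : StronglyMeasurable[sndSigma p₁ p₂] fun z : Vec p₁ p₂ × Vec p₁ p₂ => z.2 j := by
    have h2 : Measurable fun y : Vec p₁ p₂ => y j := by fun_prop
    exact (h2.comp (comap_measurable
      (Prod.snd : Vec p₁ p₂ × Vec p₁ p₂ → Vec p₁ p₂))).stronglyMeasurable
  have h3 := condExp_mul_of_stronglyMeasurable_right hYm (hX.integrable_mul hY i j)
    ((hX i).integrable one_le_two)
  have h4 := integral_condExp hle (μ := π)
    (f := (fun z : Vec p₁ p₂ × Vec p₁ p₂ => z.1 i) * fun z : Vec p₁ p₂ × Vec p₁ p₂ => z.2 j)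
  refine h4.symm.trans (integral_congr_ae ?_)
  filter_upwards [h, h1, h3] with z hz hz1 hz3
  rw [hz3, Pi.mul_apply, ← hz1, hz]

/-- The realizations whose reproduction is the conditional mean. -/
theorem condMean_eq_and_errorCov_eq_iff (hQ : Q.PosSemidef) (hQV : QV.PosSemidef) :
    (condMean (realizationLaw Q H QV) =ᵐ[realizationLaw Q H QV] Prod.snd ∧
      errorCov (realizationLaw Q H QV) = S) ↔ Realizes Q H QV S := by
  constructor
  · rintro ⟨h1, h2⟩
    have hX := sqIntegrable_fst_of_isGaussian (realizationLaw Q H QV)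
    have hY := sqIntegrable_snd_of_isGaussian (realizationLaw Q H QV)
    have hXY := crossMoment_fst_snd_of_condMean Q H QV h1
    have hYY := crossMoment_posSemidef hY
    rw [errorCov_eq_of_condMean _ h1, crossMoment_sub_left hX hY (hX.sub hY),
      crossMoment_sub_right hX hX hY, crossMoment_sub_right hY hX hY, hXY,
      crossMoment_fst hQ (realizationLaw_fst Q H QV), crossMoment_realizationLaw_snd_fst hQ] at h2
    rw [crossMoment_realizationLaw_fst_snd hQ] at hXY
    -- `Q Hᵀ` is now the second moment matrix of `X̂`, hence symmetric and positive semidefinite.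
    have hsymm : Q * Hᵀ = H * Q := by
      have := hYY.transpose_eq
      rwa [← hXY, Matrix.transpose_mul, Matrix.transpose_transpose, hQ.transpose_eq, eq_comm]
        at this
    rw [← hXY, hsymm, sub_self, sub_zero] at h2
    rw [← hXY, hsymm] at hYY
    rw [crossMoment_realizationLaw_snd hQ H hQV, hsymm] at hXY
    have hl : H * Q = Q - S := by rw [← h2, sub_sub_cancel]
    exact ⟨hl, by rw [hsymm, hl], hYY, eq_sub_of_add_eq' hXY.symm, hQV⟩
  · intro h
    refine ⟨h.condMean_eq hQ, ?_⟩
    rw [errorCov_eq_of_condMean _ (h.condMean_eq hQ), h.crossMoment_error hQ]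

/-! ### The mutual information of a realization -/

/-- The second moment matrix of `X̂` is `Q - S`, whose range is orthogonal to `ker Q`. -/
theorem Realizes.ae_kerProj_snd (hQ : Q.PosSemidef) (h : Realizes Q H QV S) :
    ∀ᵐ y ∂(realizationLaw Q H QV).snd, kerProj Q *ᵥ y.ofLp = 0 := by
  have hPS := kerProj_mul_of_mul_kerProj (h.cov_posSemidef hQ).transpose_eq
    (mul_kerProj_of_le (h.cov_posSemidef hQ) h.sub_posSemidef)
  have h1 := ae_mulVec_eq_zero_of_mul_crossMoment (sqIntegrable_snd_of_isGaussian (realizationLaw Q H QV))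
    (A := kerProj Q) (by
      rw [crossMoment_realizationLaw_snd hQ H h.noise_posSemidef, h.second_moment_eq, h.left_eq,
        Matrix.mul_sub, hPS, kerProj_mul_of_mul_kerProj hQ.transpose_eq (mul_kerProj Q), sub_zero])
  rw [Measure.snd]
  refine (ae_map_iff measurable_snd.aemeasurable ?_).2 h1
  exact measurableSet_eq_fun (by fun_prop) (by fun_prop)

/-- The backward channel `X = X̂ + E`, with `E` independent of `X̂`. -/
theorem Realizes.law_eq_map_prod (hQ : Q.PosSemidef) (h : Realizes Q H QV S) :
    realizationLaw Q H QV =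
      ((gaussian S).prod (realizationLaw Q H QV).snd).map (fun w => (w.2 + w.1, w.2)) := by
  have h1 := (indepFun_iff_map_prod_eq_prod_map_map (by fun_prop) (by fun_prop)).1
    (h.indepFun_error hQ)
  rw [h.map_error hQ, ← Measure.snd] at h1
  rw [← h1, Measure.map_map (by fun_prop) (by fun_prop)]
  conv_lhs => rw [← Measure.map_id (μ := realizationLaw Q H QV)]
  congr 1
  ext z : 1
  simp

theorem multivariateGaussian_eq_map_add (S : Mat p₁ p₂) (y : Vec p₁ p₂) :
    multivariateGaussian y S = (gaussian S).map (y + ·) := by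
  rw [gaussian, multivariateGaussian, multivariateGaussian, Measure.map_map (by fun_prop)
    (by fun_prop)]
  congr 1
  ext x : 1
  simp

/-- Given `X̂ = y`, the backward channel makes `X` distributed as `G(y, S)`; for almost every `y`
the mean lies in the range of `Q`, so the density relative to `G(0, Q)` is available, and
integration over `y` gives the joint density. -/
theorem Realizes.law_eq_withDensity (hQ : Q.PosSemidef) (h : Realizes Q H QV S)
    (hd : (S + kerProj Q).PosDef) :
    realizationLaw Q H QV = ((realizationLaw Q H QV).fst.prod
      (realizationLaw Q H QV).snd).withDensity fun z =>
        ENNReal.ofReal (Real.exp (gaussianLLR (Q + kerProj Q) (S + kerProj Q) z.1 z.2)) := by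
  have hS := h.cov_posSemidef hQ
  have hSP := mul_kerProj_of_le hS h.sub_posSemidef
  have hae := h.ae_kerProj_snd hQ
  have hlaw := h.law_eq_map_prod hQ
  rw [realizationLaw_fst]
  set ν := (realizationLaw Q H QV).snd with hν
  have hm : Measurable fun z : Vec p₁ p₂ × Vec p₁ p₂ => ENNReal.ofReal
      (Real.exp (gaussianLLR (Q + kerProj Q) (S + kerProj Q) z.1 z.2)) :=
    (continuous_gaussianLLR _ _).measurable.exp.ennreal_ofReal
  rw [hlaw]
  ext s hs
  have hφ : Measurable fun w : Vec p₁ p₂ × Vec p₁ p₂ => (w.2 + w.1, w.2) := by fun_prop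
  rw [Measure.map_apply hφ hs, Measure.prod_apply_symm (hφ hs), withDensity_apply _ hs,
    ← lintegral_indicator hs, lintegral_prod_symm _ (hm.indicator hs).aemeasurable]
  refine lintegral_congr_ae ?_
  filter_upwards [hae] with y hy
  have hsy : MeasurableSet ((fun x => (x, y)) ⁻¹' s) := measurable_prodMk_right hs
  have h1 := congrArg (fun μ => μ ((fun x => (x, y)) ⁻¹' s))
    (multivariateGaussian_eq_gaussian_withDensity hQ hS hSP hd hy)
  simp only [multivariateGaussian_eq_map_add] at h1
  rw [Measure.map_apply (by fun_prop) hsy, withDensity_apply _ hsy, ← lintegral_indicator hsy]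
    at h1
  exact h1

/-- For nondegenerate `S` this is an equality: the mean of the log-density has two trace terms, both
equal to half the trace of `1 - kerProj Q`, with opposite signs. Otherwise the rate is infinite. -/
theorem Realizes.mutualInfo_le_rate (hQ : Q.PosSemidef) (h : Realizes Q H QV S) :
    (mutualInfo (realizationLaw Q H QV) : EReal) ≤ rate Q S := by
  have hS := h.cov_posSemidef hQ
  have hSP := mul_kerProj_of_le hS h.sub_posSemidef
  by_cases hpos : 0 < (S + kerProj Q).det
  · have hd := ((hS.add (kerProj_posSemidef Q)).posDef_iff_det_ne_zero).2 hpos.ne'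
    have hX := sqIntegrable_fst_of_isGaussian (realizationLaw Q H QV)
    have hE := hX.sub (sqIntegrable_snd_of_isGaussian (realizationLaw Q H QV))
    have hint := integrable_gaussianLLR (φ := id) (M := S + kerProj Q) (N := Q + kerProj Q) hX hE
    have key := klDiv_eq_integral_of_withDensity_exp
      (measurable_gaussianLLR (Q + kerProj Q) (S + kerProj Q) measurable_id) hint
      (h.law_eq_withDensity hQ hd)
    have hval := integral_gaussianLLR (φ := id) (M := S + kerProj Q) (N := Q + kerProj Q) hX hE
    have hcm : crossMoment (realizationLaw Q H QV) (fun z => z.1.ofLp - (id z.2).ofLp)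
      (fun z => z.1.ofLp - (id z.2).ofLp) = S := h.crossMoment_error hQ
    rw [hcm, crossMoment_fst hQ (realizationLaw_fst Q H QV),
      inv_mul_add_kerProj hSP hd, inv_mul_add_kerProj (mul_kerProj Q) (posDef_add_kerProj hQ),
      sub_add_cancel] at hval
    rw [mutualInfo, key, hval, rate, halfLogRatio, if_pos hpos]
  · rw [rate, halfLogRatio, if_neg hpos]
    exact le_top

theorem Realizes.mem_feasible (hQ : Q.PosSemidef) (h : Realizes Q H QV S) {Δ₁ Δ₂ : ℝ}
    (ht : TraceLE S Δ₁ Δ₂) : realizationLaw Q H QV ∈ feasible (gaussian Q) Δ₁ Δ₂ := by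
  have hE := (sqIntegrable_fst_of_isGaussian (realizationLaw Q H QV)).sub (sqIntegrable_snd_of_isGaussian (realizationLaw Q H QV))
  refine ⟨inferInstance, realizationLaw_fst Q H QV, ?_, ?_⟩
  · rw [distortion₁_eq hE, h.crossMoment_error hQ]
    exact ENNReal.ofReal_le_ofReal ht.1
  · rw [distortion₂_eq hE, h.crossMoment_error hQ]
    exact ENNReal.ofReal_le_ofReal ht.2

end Realization

/-! ### The joint rate distortion function -/

section RateDistortion

variable {p₁ p₂ : ℕ} {Q S : Mat p₁ p₂}

theorem rate_le_rdf (hQ : Q.PosSemidef) {Δ₁ Δ₂ : ℝ} (h₁ : 0 ≤ Δ₁) (h₂ : 0 ≤ Δ₂)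
    (hmin : ∀ T ∈ constraintSetPD Q Δ₁ Δ₂, rate Q S ≤ rate Q T) :
    rate Q S ≤ (rdf (gaussian Q) Δ₁ Δ₂ : EReal) := by
  have key : ∀ π ∈ feasible (gaussian Q) Δ₁ Δ₂, (rate Q S).toENNReal ≤ mutualInfo π := by
    intro π hπ
    obtain ⟨T, hT, hle⟩ := rate_le_mutualInfo hQ h₁ h₂ hπ
    have := EReal.toENNReal_le_toENNReal ((hmin T hT).trans hle)
    rwa [EReal.toENNReal_coe] at this
  have h : (rate Q S).toENNReal ≤ rdf (gaussian Q) Δ₁ Δ₂ := le_iInf₂ key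
  -- Truncating the rate at `0` can only increase it, so its sign need not be known.
  exact (le_max_right _ _ |>.trans_eq (EReal.coe_toENNReal_eq_max).symm).trans (EReal.coe_ennreal_le_coe_ennreal_iff.2 h)

/-- An optimal test channel, and the value of the joint rate distortion function. -/
theorem exists_optimal_realization (hQ : Q.PosSemidef) {Δ₁ Δ₂ : ℝ} (h₁ : 0 ≤ Δ₁)
    (h₂ : 0 ≤ Δ₂) :
    ∃ H QV S : Mat p₁ p₂, Realizes Q H QV S ∧ TraceLE S Δ₁ Δ₂ ∧
      realizationLaw Q H QV ∈ feasible (gaussian Q) Δ₁ Δ₂ ∧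
      mutualInfo (realizationLaw Q H QV) = rdf (gaussian Q) Δ₁ Δ₂ ∧
      rate Q S = (rdf (gaussian Q) Δ₁ Δ₂ : EReal) ∧
      ∀ T ∈ constraintSetPD Q Δ₁ Δ₂, rate Q S ≤ rate Q T := by
  obtain ⟨S, hS, hmin⟩ := exists_rate_minimizer hQ h₁ h₂
  obtain ⟨H, QV, h⟩ := exists_realizes hQ hS.2.1 hS.1
  have hf := h.mem_feasible hQ hS.2.2
  have hle := rate_le_rdf hQ h₁ h₂ hmin
  have hub : rdf (gaussian Q) Δ₁ Δ₂ ≤ mutualInfo (realizationLaw Q H QV) := iInf₂_le _ hf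
  have hI := h.mutualInfo_le_rate hQ
  -- The chain rate ≤ RDF ≤ mutual information ≤ rate closes up, so all three agree.
  exact ⟨H, QV, S, h, hS.2.2, hf,
    le_antisymm (EReal.coe_ennreal_le_coe_ennreal_iff.1 (hI.trans hle)) hub,
    le_antisymm hle ((EReal.coe_ennreal_le_coe_ennreal_iff.2 hub).trans hI), hmin⟩

theorem rdf_eq_iInf_rate (hQ : Q.PosSemidef) {Δ₁ Δ₂ : ℝ} (h₁ : 0 ≤ Δ₁) (h₂ : 0 ≤ Δ₂) :
    (rdf (gaussian Q) Δ₁ Δ₂ : EReal) = ⨅ S ∈ constraintSetPD Q Δ₁ Δ₂, rate Q S := by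
  obtain ⟨H, QV, S, h, ht, -, -, hr, hmin⟩ := exists_optimal_realization hQ h₁ h₂
  rw [← hr]
  exact le_antisymm (le_iInf₂ hmin)
    (iInf₂_le S ⟨h.sub_posSemidef, h.cov_posSemidef hQ, ht⟩)

end RateDistortion

end JointRDF

end

/-! ### The main theorem -/

theorem mainTheorem1 (p₁ p₂ : ℕ) (hp₁ : 0 < p₁) (hp₂ : 0 < p₂)
    (Q : JointRDF.Mat p₁ p₂) (hQ : Q.PosSemidef)
    (Δ₁ Δ₂ : ℝ) (hΔ₁ : 0 ≤ Δ₁) (hΔ₂ : 0 ≤ Δ₂) :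
    -- (a) the realizations whose reproduction is the conditional mean, with error covariance `S`
    (∀ H QV S : JointRDF.Mat p₁ p₂, QV.PosSemidef →
      ((JointRDF.condMean (JointRDF.realizationLaw Q H QV)
            =ᵐ[JointRDF.realizationLaw Q H QV] Prod.snd ∧
          JointRDF.errorCov (JointRDF.realizationLaw Q H QV) = S) ↔
        JointRDF.Realizes Q H QV S)) ∧
    -- (a) an optimal test channel is induced by such a realization
    (∃ H QV S : JointRDF.Mat p₁ p₂,
      JointRDF.Realizes Q H QV S ∧
      JointRDF.TraceLE S Δ₁ Δ₂ ∧
      JointRDF.realizationLaw Q H QV ∈ JointRDF.feasible (JointRDF.gaussian Q) Δ₁ Δ₂ ∧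
      JointRDF.mutualInfo (JointRDF.realizationLaw Q H QV) =
        JointRDF.rdf (JointRDF.gaussian Q) Δ₁ Δ₂ ∧
      JointRDF.rate Q S = (JointRDF.rdf (JointRDF.gaussian Q) Δ₁ Δ₂ : EReal)) ∧
    -- (a) the characterization of the joint RDF
    ((JointRDF.rdf (JointRDF.gaussian Q) Δ₁ Δ₂ : EReal) =
      ⨅ S ∈ JointRDF.constraintSet Q Δ₁ Δ₂, JointRDF.rate Q S) ∧
    -- (b) the case of a positive definite source covariance
    (Q.PosDef → JointRDF.rdf (JointRDF.gaussian Q) Δ₁ Δ₂ < ⊤ →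
      (∀ H QV S : JointRDF.Mat p₁ p₂, JointRDF.Realizes Q H QV S →
        H = 1 - S * Q⁻¹ ∧ QV = S - S * Q⁻¹ * S ∧
          (S - S * Q⁻¹ * S).PosSemidef ∧ (Q - S).PosSemidef) ∧
      (∀ S : JointRDF.Mat p₁ p₂, S.PosSemidef →
        ((Q - S).PosSemidef ↔ (S - S * Q⁻¹ * S).PosSemidef)) ∧
      JointRDF.constraintSet Q Δ₁ Δ₂ = JointRDF.constraintSetPD Q Δ₁ Δ₂ ∧
      (JointRDF.rdf (JointRDF.gaussian Q) Δ₁ Δ₂ : EReal) =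
        ⨅ S ∈ JointRDF.constraintSetPD Q Δ₁ Δ₂, JointRDF.halfLogRatio Q.det S.det) := by

  refine ⟨fun H QV S hQV => JointRDF.condMean_eq_and_errorCov_eq_iff hQ hQV, ?_, ?_, ?_⟩
  · obtain ⟨H, QV, S, h, ht, hf, hI, hr, -⟩ := JointRDF.exists_optimal_realization hQ hΔ₁ hΔ₂
    exact ⟨H, QV, S, h, ht, hf, hI, hr⟩
  · rw [JointRDF.constraintSet_eq_constraintSetPD hQ]
    exact JointRDF.rdf_eq_iInf_rate hQ hΔ₁ hΔ₂
  · intro hpd _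
    refine ⟨fun H QV S h => ?_, fun S hS => JointRDF.sub_posSemidef_iff hpd hS,
      JointRDF.constraintSet_eq_constraintSetPD hQ Δ₁ Δ₂, ?_⟩
    · obtain ⟨hH, hN⟩ := h.eq_of_posDef hpd
      exact ⟨hH, hN, hN ▸ h.noise_posSemidef, h.sub_posSemidef⟩
    · rw [JointRDF.rdf_eq_iInf_rate hQ hΔ₁ hΔ₂]
      simp only [JointRDF.rate_of_posDef hpd]
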